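/- Let $c\in(0,1)$ and let $(p_j)_{j\ge 0}$ be a probability distribution on $\{0,1,2,\dots\}$ with finite mean $d=\sum_{j\ge1} j\,p_j$. Let $N$ be a random variable with values in $\{0,1,2,\dots\}$ with $\mathbb{E}(N)=d<\infty$ that is regularly varying with index $\alpha$, i.e. $\mathbb{P}(N>x)\sim x^{-\alpha}L(x)$ as $x\to\infty$ for some positive function $L$ on $(0,\infty)$ such that $L(tx)/L(x)\to1$ as $x\to\infty$ for every $t>0$; here $a(x)\sim b(x)$ means $a(x)/b(x)\to1$. Let $D$ be a random variable with values in $\{1,2,\dots\}$ and $\mathbb{P}(D=j)=j p_j/d$ for $j\ge1$. Let $R^{(0)}$ be a real random variable with $\mathbb{E}(R^{(0)})=1$, and define the laws of $R^{(1)},R^{(2)},\dots$ recursively by $$R^{(k)}\stackrel{d}{=}c\sum_{j=1}^{N}\frac{1}{D_j}R^{(k-1)}_j+[1-c(1-p_0)],\qquad k\ge1,$$ where $N$, $D_1,D_2,\dots$, $R^{(k-1)}_1,R^{(k-1)}_2,\dots$ are independent, each $D_j$ is distributed as $D$ and each $R^{(k-1)}_j$ is distributed as $R^{(k-1)}$.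 If $\mathbb{P}(R^{(0)}>x)=o(\mathbb{P}(N>x))$ as $x\to\infty$, then for every $k\ge1$ $$\mathbb{P}(R^{(k)}>x)\sim C_k\,\mathbb{P}(N>x)\quad\text{as }x\to\infty,$$ where $$C_k=\left(\frac{c(1-p_0)}{d}\right)^{\alpha}\sum_{j=0}^{k-1}c^{j\alpha}b^j,\qquad b=d\,\mathbb{E}\left(\frac{1}{D^{\alpha}}\right)=\sum_{j=1}^{\infty}\frac{p_j}{j^{\alpha-1}}<\infty .$$ -/

import Mathlib

open MeasureTheory ProbabilityTheory Filter Topology Asymptotics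

namespace PageRank

/-- `a(x) ∼ b(x)` as `x → ∞`, i.e. `a(x) / b(x) → 1`. -/
def AsympEquiv (a b : ℝ → ℝ) : Prop :=
  Tendsto (fun x => a x / b x) atTop (𝓝 1)

/-- `L` is slowly varying: `L(tx) / L(x) → 1` as `x → ∞`, for every `t > 0`. -/
def SlowlyVarying (L : ℝ → ℝ) : Prop :=
  ∀ t : ℝ, 0 < t → Tendsto (fun x => L (t * x) / L x) atTop (𝓝 1)

/-- The tail function `x ↦ P(X > x)` of a real random variable. -/
noncomputable def tail {Ω : Type*} [MeasurableSpace Ω] (P : Measure Ω) (X : Ω → ℝ) (x : ℝ) : ℝ :=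
  P.real {ω | x < X ω}

/-- A non-negative random variable `X` is regularly varying with index `α` if
`P(X > x) ∼ x ^ (-α) * L(x)` for some positive slowly varying function `L` on `(0, ∞)`. -/
def RegularlyVarying {Ω : Type*} [MeasurableSpace Ω] (P : Measure Ω) (X : Ω → ℝ) (α : ℝ) : Prop :=
  (∀ᵐ ω ∂P, 0 ≤ X ω) ∧
    ∃ L : ℝ → ℝ, (∀ x, 0 < x → 0 < L x) ∧ SlowlyVarying L ∧
      AsympEquiv (tail P X) (fun x => x ^ (-α) * L x)

/-- The law of a random variable, as a bundled probability measure. -/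
noncomputable def law {Ω E : Type*} [MeasurableSpace Ω] [MeasurableSpace E]
    (P : Measure Ω) [IsProbabilityMeasure P] (X : Ω → E) (hX : Measurable X) :
    ProbabilityMeasure E :=
  ⟨P.map X, Measure.isProbabilityMeasure_map hX.aemeasurable⟩

/-- The right-hand side of the stochastic equation,
`c * ∑_{j = 1}^{N} (1 / D_j) * R_j + [1 - c (1 - p₀)]`, as a function of
`(N, (D_j)_j, (R_j)_j)`; the sequences are indexed from `0`. -/
noncomputable def rhs (c p₀ : ℝ) (s : ℕ × (ℕ → ℕ) × (ℕ → ℝ)) : ℝ :=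
  c * ∑ j ∈ Finset.range s.1, 1 / (s.2.1 j : ℝ) * s.2.2 j + (1 - c * (1 - p₀))

theorem measurable_rhs (c p₀ : ℝ) : Measurable (rhs c p₀) := by
  apply measurable_from_prod_countable_right
  intro n
  have h (j : ℕ) : Measurable fun t : (ℕ → ℕ) × (ℕ → ℝ) => ((t.1 j : ℕ) : ℝ) :=
    (measurable_from_nat (f := fun m : ℕ => (m : ℝ))).comp
      ((measurable_pi_apply j).comp measurable_fst)
  have hs : Measurable fun t : (ℕ → ℕ) × (ℕ → ℝ) =>
      ∑ j ∈ Finset.range n, 1 / (t.1 j : ℝ) * t.2 j :=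
    Finset.measurable_fun_sum _ fun j _ =>
      ((h j).const_div 1).mul ((measurable_pi_apply j).comp measurable_snd)
  exact (hs.const_mul c).add_const _

/-- One iteration: the law of `c * ∑_{j = 1}^{N} (1 / D_j) * R_j + [1 - c (1 - p₀)]`, where
`N`, the `D_j` and the `R_j` are all independent, `N` has law `lawN`, each `D_j` has law `lawD`
and each `R_j` has law `lawR`. -/
noncomputable def iterStep (c p₀ : ℝ) (lawN lawD : ProbabilityMeasure ℕ)
    (lawR : ProbabilityMeasure ℝ) : ProbabilityMeasure ℝ :=
  law ((lawN : Measure ℕ).prod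
      ((Measure.infinitePi fun _ : ℕ => (lawD : Measure ℕ)).prod
        (Measure.infinitePi fun _ : ℕ => (lawR : Measure ℝ))))
    (rhs c p₀) (measurable_rhs c p₀)

/-- The law of the `k`-th iterate `R^(k)`, started from the law `lawR₀` of `R^(0)`. -/
noncomputable def iterLaw (c p₀ : ℝ) (lawN lawD : ProbabilityMeasure ℕ)
    (lawR₀ : ProbabilityMeasure ℝ) : ℕ → ProbabilityMeasure ℝ
  | 0 => lawR₀
  | k + 1 => iterStep c p₀ lawN lawD (iterLaw c p₀ lawN lawD lawR₀ k)

end PageRank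

/-! Write G for the tail of N, X_j = R_j / D_j, and μ = (1 - p₀) / d for the mean of X_j. If P(R >
x) / G(x) → κ, then P(X_j > x) / G(x) → κ E(D^(-α)), by conditioning on D
(`tendsto_tail_one_div_mul`). A sum of N such terms exceeds a high level x in essentially two ways.
Either N exceeds x / μ, which suffices by the law of large numbers and contributes μ^α G(x); or N is
moderate and a single term is of size x, which contributes E(N) P(X > x), that is, bκ G(x).
Multiplication by c turns the constant into c^α times itself, and the additive constant is
negligible. Hence one iteration preserves the mean 1 and maps κ to c^α (μ^α + bκ) (`iterStep_spec`).
The assumption on R^(0) says κ = 0 at the start, and unrolling the affine map gives the geometric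
sum C_k.

The delicate point is the single-big-jump contribution. For fixed n it is `tendsto_tail_sum`, but
summing against P(N = n) needs uniformity in n. This is `exists_tail_sum_le`: P(S_n > x) ≤ C n G(x)
as long as nθ ≤ x, with θ > μ. Since E(N) is finite, C n P(N = n) is a summable majorant, and
`tendsto_tail_randomSum` combines both contributions. The uniform bound is a Chernoff estimate for
truncated terms; it uses no variance, only the finite mean and power-type bounds for G. -/

namespace PageRank

/-! ### Regularly varying tail functions. -/

/-- `G` behaves like the tail function of a random variable with unbounded support which is
regularly varying with index `α`. -/
structure RegVarTail (G : ℝ → ℝ) (α : ℝ) : Prop where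
  pos : ∀ x, 0 < G x
  le_one : ∀ x, G x ≤ 1
  anti : Antitone G
  ratio : ∀ t, 0 < t → Tendsto (fun x => G (t * x) / G x) atTop (𝓝 (t ^ (-α)))

namespace RegVarTail

variable {G : ℝ → ℝ} {α : ℝ}

theorem index_nonneg (hG : RegVarTail G α) : 0 ≤ α := by
  have h : (2 : ℝ) ^ (-α) ≤ 1 := by
    refine le_of_tendsto (hG.ratio 2 two_pos) ?_
    filter_upwards [eventually_ge_atTop 0] with x hx
    rw [div_le_one (hG.pos x)]
    exact hG.anti (by linarith)
  by_contra! hα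
  exact absurd h (not_le.2 (Real.one_lt_rpow one_lt_two (by linarith)))

/-- A bounded ratio at infinity is a bounded ratio everywhere. -/
theorem le_mul_of_eventually_le (hG : RegVarTail G α) {F : ℝ → ℝ} {K : ℝ}
    (hF : ∀ x, F x ≤ 1) (h : ∀ᶠ x in atTop, F x ≤ K * G x) :
    ∃ K' : ℝ, 0 < K' ∧ ∀ x, F x ≤ K' * G x := by
  obtain ⟨x₀, hx₀⟩ := eventually_atTop.1 h
  have h0 := hG.pos x₀
  refine ⟨max K (1 / G x₀), lt_max_of_lt_right (by positivity), fun x => ?_⟩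
  rcases le_total x₀ x with hx | hx
  · exact (hx₀ x hx).trans (mul_le_mul_of_nonneg_right (le_max_left _ _) (hG.pos x).le)
  · calc F x ≤ 1 := hF x
      _ = 1 / G x₀ * G x₀ := by field_simp
      _ ≤ 1 / G x₀ * G x := mul_le_mul_of_nonneg_left (hG.anti hx) (by positivity)
      _ ≤ _ := mul_le_mul_of_nonneg_right (le_max_right _ _) (hG.pos x).le

/-- Having a single constant valid for every x, and not only for large x, is what allows the
inductions over dyadic scales below. -/
theorem exists_scale_le (hG : RegVarTail G α) {t : ℝ} (ht : 0 < t) :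
    ∃ A : ℝ, 0 < A ∧ ∀ x, G (t * x) ≤ A * G x := by
  refine hG.le_mul_of_eventually_le (K := t ^ (-α) + 1) (fun x => hG.le_one _) ?_
  filter_upwards [(hG.ratio t ht).eventually_le_const (lt_add_one _)] with x hx
  rwa [div_le_iff₀ (hG.pos x)] at hx

theorem exists_le_mul_of_tendsto (hG : RegVarTail G α) {F : ℝ → ℝ} {κ : ℝ}
    (hF : ∀ x, F x ≤ 1) (h : Tendsto (fun x => F x / G x) atTop (𝓝 κ)) :
    ∃ K : ℝ, 0 < K ∧ ∀ x, F x ≤ K * G x := by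
  refine hG.le_mul_of_eventually_le (K := κ + 1) hF ?_
  filter_upwards [h.eventually_le_const (lt_add_one _)] with x hx
  rwa [div_le_iff₀ (hG.pos x)] at hx

/-- A Potter-type bound: each halving of x costs a factor A in G, and q is chosen with A < 2^q so
that the power of x pays for it. -/
theorem exists_pow_le (hG : RegVarTail G α) :
    ∃ (q : ℕ) (a : ℝ), 0 < a ∧ ∀ x, 1 ≤ x → a ≤ G x * x ^ q := by
  obtain ⟨A, hA, hGA⟩ := hG.exists_scale_le (t := 1 / 2) (by norm_num)
  obtain ⟨q, hq⟩ := pow_unbounded_of_one_lt A one_lt_two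
  have key : ∀ (n : ℕ) (x : ℝ), 1 ≤ x → x ≤ 2 ^ n → min (G 1) (G 1 / A) ≤ G x * x ^ q := by
    intro n
    induction n with
    | zero =>
      intro x h1 h2
      have : x = 1 := le_antisymm (by simpa using h2) h1
      subst this
      simp
    | succ n ih =>
      intro x h1 h2
      have hx := hGA x
      have hpos := hG.pos x
      rcases le_total x 2 with h | h
      · have h3 : G 1 ≤ G (1 / 2 * x) := hG.anti (by linarith)
        have h4 : (1 : ℝ) ≤ x ^ q := one_le_pow₀ h1
        calc min (G 1) (G 1 / A) ≤ G 1 / A := min_le_right _ _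
          _ ≤ G x := by rw [div_le_iff₀ hA]; linarith
          _ ≤ G x * x ^ q := le_mul_of_one_le_right hpos.le h4
      · refine (ih (1 / 2 * x) (by linarith) (by rw [pow_succ] at h2; linarith)).trans ?_
        have h5 : (0 : ℝ) ≤ (1 / 2 * x) ^ q := by positivity
        calc G (1 / 2 * x) * (1 / 2 * x) ^ q ≤ A * G x * (1 / 2 * x) ^ q :=
              mul_le_mul_of_nonneg_right hx h5
          _ ≤ 2 ^ q * G x * (1 / 2 * x) ^ q := by gcongr
          _ = G x * x ^ q := by
            rw [mul_pow, one_div, inv_pow]; field_simp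
  refine ⟨q, min (G 1) (G 1 / A), lt_min (hG.pos 1) (div_pos (hG.pos 1) hA), fun x hx => ?_⟩
  obtain ⟨n, hn⟩ := pow_unbounded_of_one_lt x one_lt_two
  exact key n x hx hn.le

/-- The Chernoff parameter used later is at most log(1 / G x) / (δx); this makes it small. It
follows from the polynomial lower bound on G. -/
theorem tendsto_log_div (hG : RegVarTail G α) :
    Tendsto (fun x => Real.log (1 / G x) / x) atTop (𝓝 0) := by
  obtain ⟨q, a, ha, h⟩ := hG.exists_pow_le
  have hlog : Tendsto (fun x : ℝ => Real.log x / x) atTop (𝓝 0) :=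
    Real.isLittleO_log_id_atTop.tendsto_div_nhds_zero
  have hup : Tendsto (fun x : ℝ => Real.log (1 / a) * x⁻¹ + q * (Real.log x / x)) atTop (𝓝 0) := by
    simpa using (tendsto_inv_atTop_zero.const_mul (Real.log (1 / a))).add (hlog.const_mul (q : ℝ))
  refine tendsto_of_tendsto_of_tendsto_of_le_of_le' tendsto_const_nhds hup ?_ ?_
  · filter_upwards [eventually_ge_atTop 1] with x hx
    refine div_nonneg (Real.log_nonneg ?_) (by linarith)
    rw [le_div_iff₀ (hG.pos x)]
    linarith [hG.le_one x]
  · filter_upwards [eventually_ge_atTop 1] with x hx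
    have hx0 : 0 < x := by linarith
    have hGx := hG.pos x
    have h1 : Real.log (1 / G x) ≤ Real.log (1 / a) + q * Real.log x := by
      rw [← Real.log_pow, ← Real.log_mul (by positivity) (by positivity)]
      refine Real.log_le_log (by positivity) ?_
      rw [div_le_iff₀ hGx, one_div, mul_assoc, inv_mul_eq_div, le_div_iff₀ ha]
      linarith [h x hx, mul_comm (G x) (x ^ q)]
    calc Real.log (1 / G x) / x ≤ (Real.log (1 / a) + q * Real.log x) / x := by gcongr
      _ = _ := by field_simp

/-- Regular variation passes to arguments that are only asymptotically linear. -/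
theorem tendsto_of_scale (hG : RegVarTail G α) {F : ℝ → ℝ} {κ t : ℝ} (hF : Antitone F)
    (h : Tendsto (fun x => F x / G x) atTop (𝓝 κ)) (ht : 0 < t) (a : ℝ) :
    Tendsto (fun x => F (t * x + a) / G x) atTop (𝓝 (κ * t ^ (-α))) := by
  have hs (r : ℝ) (hr : 0 < r) : Tendsto (fun x => F (r * x) / G x) atTop (𝓝 (κ * r ^ (-α))) := by
    have h1 : Tendsto (fun x : ℝ => r * x) atTop atTop := tendsto_id.const_mul_atTop hr
    refine ((h.comp h1).mul (hG.ratio r hr)).congr fun x => ?_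
    have := (hG.pos (r * x)).ne'
    simp only [Function.comp]
    field_simp
  have hc : ContinuousAt (fun r : ℝ => κ * r ^ (-α)) t :=
    continuousAt_const.mul (Real.continuousAt_rpow_const _ _ (Or.inl ht.ne'))
  -- For r > t one has tx + a ≤ rx eventually, and the reverse for r < t. Monotonicity of F
  -- sandwiches the ratio, and continuity of r^(-α) lets r approach t.
  rw [tendsto_order]
  constructor
  · intro b hb
    have h1 : ∀ᶠ r in 𝓝[>] t, b < κ * r ^ (-α) :=
      (hc.eventually (lt_mem_nhds hb)).filter_mono nhdsWithin_le_nhds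
    obtain ⟨r, hr, hrt⟩ := (h1.and self_mem_nhdsWithin).exists
    have hrt : t < r := hrt
    filter_upwards [(hs r (ht.trans hrt)).eventually_const_lt hr,
      eventually_ge_atTop (a / (r - t))] with x hx hxa
    refine hx.trans_le (div_le_div_of_nonneg_right (hF ?_) (hG.pos x).le)
    rw [div_le_iff₀ (by linarith)] at hxa
    nlinarith
  · intro b hb
    have h1 : ∀ᶠ r in 𝓝[<] t, κ * r ^ (-α) < b ∧ 0 < r :=
      ((hc.eventually (gt_mem_nhds hb)).and (lt_mem_nhds ht)).filter_mono nhdsWithin_le_nhds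
    obtain ⟨r, ⟨hr, hr0⟩, hrt⟩ := (h1.and self_mem_nhdsWithin).exists
    have hrt : r < t := hrt
    filter_upwards [(hs r hr0).eventually_lt_const hr,
      eventually_ge_atTop (-a / (t - r))] with x hx hxa
    refine (div_le_div_of_nonneg_right (hF ?_) (hG.pos x).le).trans_lt hx
    rw [div_le_iff₀ (by linarith)] at hxa
    nlinarith

end RegVarTail

/-! ### Tails and truncated moments. -/

section Moments

variable {Ω : Type*} [MeasurableSpace Ω] {P : Measure Ω} [IsProbabilityMeasure P]
  {G : ℝ → ℝ} {α : ℝ}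

theorem tail_le_one (X : Ω → ℝ) (x : ℝ) : tail P X x ≤ 1 := measureReal_le_one

omit [IsProbabilityMeasure P] in
theorem tail_nonneg (X : Ω → ℝ) (x : ℝ) : 0 ≤ tail P X x := measureReal_nonneg

theorem tail_antitone (X : Ω → ℝ) : Antitone (tail P X) := fun _ _ h =>
  measureReal_mono fun _ hω => lt_of_le_of_lt h hω

/-- Truncated moments of high order of a random variable whose tail is dominated by `G`. -/
theorem exists_truncated_moment_le (hG : RegVarTail G α) {X : Ω → ℝ} (hX : Measurable X)
    {K : ℝ} (hK : 0 < K) (hXG : ∀ x, tail P X x ≤ K * G x) :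
    ∃ (p : ℕ) (B : ℝ), 0 < B ∧ ∀ y, 0 < y →
      ∫ ω, (min (max (X ω) 0) y) ^ p ∂P ≤ B * y ^ p * G y := by
  obtain ⟨A, hA, hGA⟩ := hG.exists_scale_le (t := 1 / 2) (by norm_num)
  -- With 2A < 2^p, passing from level y/2 to y at least halves the inherited bound, which leaves
  -- room for the new layer {X > y/2}.
  obtain ⟨p, hp⟩ := pow_unbounded_of_one_lt (2 * A) one_lt_two
  have hint (y : ℝ) (hy : 0 < y) : Integrable (fun ω => (min (max (X ω) 0) y) ^ p) P := by
    refine Integrable.of_bound (C := y ^ p) (by fun_prop) (ae_of_all _ fun ω => ?_)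
    have h0 : 0 ≤ min (max (X ω) 0) y := le_min (le_max_right _ _) hy.le
    rw [Real.norm_of_nonneg (by positivity)]
    exact pow_le_pow_left₀ h0 (min_le_right _ _) p
  -- The first condition settles y ≤ 1 by the trivial bound y^p; the second makes the layer {X >
  -- y/2} cost at most half of the claimed bound.
  obtain ⟨B, hB1, hB2⟩ : ∃ B : ℝ, 1 / G 1 ≤ B ∧ 2 * K * A ≤ B :=
    ⟨max (1 / G 1) (2 * K * A), le_max_left _ _, le_max_right _ _⟩
  have hB : 0 < B := lt_of_lt_of_le (by have := hG.pos 1; positivity) hB1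
  have key : ∀ (n : ℕ) (y : ℝ), 0 < y → y ≤ 2 ^ n →
      ∫ ω, (min (max (X ω) 0) y) ^ p ∂P ≤ B * y ^ p * G y := by
    intro n
    induction n with
    | zero =>
      intro y hy hy1
      have h1 : ∫ ω, (min (max (X ω) 0) y) ^ p ∂P ≤ ∫ _, y ^ p ∂P := by
        refine integral_mono (hint y hy) (integrable_const _) fun ω => ?_
        exact pow_le_pow_left₀ (le_min (le_max_right _ _) hy.le) (min_le_right _ _) p
      have h2 : 1 ≤ B * G y := by
        have h3 : G 1 ≤ G y := hG.anti (by simpa using hy1)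
        have h4 := hG.pos 1
        rw [div_le_iff₀ h4] at hB1
        nlinarith
      have h5 : 0 < y ^ p := by positivity
      simp only [integral_const, probReal_univ, smul_eq_mul, one_mul] at h1
      nlinarith
    | succ n ih =>
      intro y hy hyn
      have hy2 : 0 < 1 / 2 * y := by linarith
      have ih' := ih (1 / 2 * y) hy2 (by rw [pow_succ] at hyn; linarith)
      have hms : MeasurableSet {ω | 1 / 2 * y < X ω} := measurableSet_lt measurable_const hX
      have h1 : ∫ ω, (min (max (X ω) 0) y) ^ p ∂P ≤
          ∫ ω, ((min (max (X ω) 0) (1 / 2 * y)) ^ p +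
            Set.indicator {ω | 1 / 2 * y < X ω} (fun _ => y ^ p) ω) ∂P := by
        refine integral_mono (hint y hy) ((hint _ hy2).add
          ((integrable_const _).indicator hms)) fun ω => ?_
        have h0 : 0 ≤ min (max (X ω) 0) y := le_min (le_max_right _ _) hy.le
        have h0' : 0 ≤ min (max (X ω) 0) (1 / 2 * y) := le_min (le_max_right _ _) hy2.le
        by_cases hω : 1 / 2 * y < X ω
        · simp only [Set.indicator, Set.mem_ofPred_eq, hω, if_true]
          have := pow_le_pow_left₀ h0 (min_le_right _ _) p
          have := pow_nonneg h0' p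
          linarith
        · simp only [Set.indicator, Set.mem_ofPred_eq, hω, if_false, add_zero]
          have h3 : max (X ω) 0 ≤ 1 / 2 * y := max_le (not_lt.1 hω) hy2.le
          rw [min_eq_left h3, min_eq_left (h3.trans (by linarith))]
      rw [integral_add (hint _ hy2) ((integrable_const _).indicator hms),
        integral_indicator_const _ hms, smul_eq_mul] at h1
      have h2 : P.real {ω | 1 / 2 * y < X ω} ≤ K * (A * G y) :=
        (hXG _).trans (mul_le_mul_of_nonneg_left (hGA y) hK.le)
      have hyp : 0 < y ^ p := by positivity
      have hGy := hG.pos y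
      have h3 : B * (1 / 2 * y) ^ p * G (1 / 2 * y) ≤ B / 2 * (y ^ p * G y) := by
        calc B * (1 / 2 * y) ^ p * G (1 / 2 * y) ≤ B * (1 / 2 * y) ^ p * (A * G y) := by
              gcongr; exact hGA y
          _ = B * (2 * A * ((1 / 2) ^ p)) / 2 * (y ^ p * G y) := by rw [mul_pow]; ring
          _ ≤ B * 1 / 2 * (y ^ p * G y) := by
            have : 2 * A * (1 / 2) ^ p ≤ 1 := by
              rw [one_div, inv_pow, ← div_eq_mul_inv, div_le_one (by positivity)]; exact hp.le
            gcongr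
          _ = _ := by ring
      have h4 : P.real {ω | 1 / 2 * y < X ω} * y ^ p ≤ B / 2 * (y ^ p * G y) := by
        calc P.real {ω | 1 / 2 * y < X ω} * y ^ p ≤ K * (A * G y) * y ^ p := by gcongr
          _ = (K * A) * (y ^ p * G y) := by ring
          _ ≤ _ := by
            have : K * A ≤ B / 2 := by linarith
            gcongr
      linarith
  refine ⟨p, B, hB, fun y hy => ?_⟩
  obtain ⟨n, hn⟩ := pow_unbounded_of_one_lt y one_lt_two
  exact key n y hy hn.le

end Moments

/-! ### Exponential moments of truncated variables and the uniform tail bound. -/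

/-- The second-order remainder of `v ↦ exp (s * v)`, rescaled by `s` and cut off at `p / s`. -/
noncomputable def expRemainder (p : ℕ) (s v : ℝ) : ℝ :=
  if s * v ≤ p then (Real.exp (s * v) - 1 - s * v) / s else 0

theorem measurable_expRemainder (p : ℕ) (s : ℝ) : Measurable (expRemainder p s) :=
  Measurable.ite (measurableSet_le (by fun_prop) measurable_const) (by fun_prop) measurable_const

/-- Below the cutoff p / s the remainder makes this exact up to a nonnegative term. Above it,
exp(su) / u^p is increasing in u, so its value at min v y is at most its value at y. -/
theorem exp_mul_min_le {p : ℕ} {s y : ℝ} (hs : 0 < s) (hy : 0 < y) (hsy : p ≤ s * y) (v : ℝ) :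
    Real.exp (s * min v y) ≤ 1 + s * min v y + s * expRemainder p s v +
      Real.exp (s * y) * (min (max v 0) y / y) ^ p := by
  have h0 : 0 ≤ min (max v 0) y := le_min (le_max_right _ _) hy.le
  unfold expRemainder
  split_ifs with h
  · have hvy : v ≤ y := by
      have := h.trans hsy
      exact le_of_mul_le_mul_left this hs
    have h1 : 0 ≤ Real.exp (s * y) * (min (max v 0) y / y) ^ p := by positivity
    rw [min_eq_left hvy, mul_div_cancel₀ _ hs.ne']
    linarith
  · push Not at h
    have hv : 0 < v := by
      by_contra! hv
      have : s * v ≤ 0 := mul_nonpos_of_nonneg_of_nonpos hs.le hv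
      have : (0 : ℝ) ≤ p := p.cast_nonneg
      linarith
    rw [max_eq_left hv.le]
    set m := min v y with hm
    have hm0 : 0 < m := lt_min hv hy
    have hmy : m ≤ y := min_le_right _ _
    have hpm : p ≤ s * m := by
      rcases min_choice v y with h' | h' <;> rw [hm, h'] <;> linarith
    -- From u ≤ exp(u - 1) with u = y / m, followed by p ≤ sm in the exponent.
    have h1 : (y / m) ^ p ≤ Real.exp (s * y - s * m) := by
      have h2 : y / m ≤ Real.exp (y / m - 1) := by
        have := Real.add_one_le_exp (y / m - 1)
        linarith
      calc (y / m) ^ p ≤ Real.exp (y / m - 1) ^ p := pow_le_pow_left₀ (by positivity) h2 p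
        _ = Real.exp (p * (y / m - 1)) := by rw [← Real.exp_nat_mul]
        _ ≤ Real.exp (s * y - s * m) := by
          refine Real.exp_le_exp.2 ?_
          have h3 : 0 ≤ y / m - 1 := by rw [sub_nonneg, one_le_div hm0]; exact hmy
          calc p * (y / m - 1) ≤ s * m * (y / m - 1) := mul_le_mul_of_nonneg_right hpm h3
            _ = _ := by field_simp
    have h4 : Real.exp (s * m) ≤ Real.exp (s * y) * (m / y) ^ p := by
      rw [Real.exp_sub, le_div_iff₀ (Real.exp_pos _)] at h1
      calc Real.exp (s * m) = (y / m) ^ p * Real.exp (s * m) * (m / y) ^ p := by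
            rw [div_pow, div_pow]; field_simp
        _ ≤ _ := by gcongr
    have : 0 < s * m := by positivity
    linarith

/-- The cutoff s v ≤ p keeps the exponential below exp p, so after division by s the bound is linear
in |v| and uniform in s: a majorant that needs only a first moment. -/
theorem abs_expRemainder_le {p : ℕ} {s : ℝ} (hs : 0 < s) (v : ℝ) :
    |expRemainder p s v| ≤ Real.exp p * |v| := by
  have hp : (1 : ℝ) ≤ Real.exp p := Real.one_le_exp p.cast_nonneg
  unfold expRemainder
  split_ifs with h
  · have h1 : 0 ≤ Real.exp (s * v) - 1 - s * v := by linarith [Real.add_one_le_exp (s * v)]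
    rw [abs_of_nonneg (by positivity), div_le_iff₀ hs]
    rcases le_total 0 v with hv | hv
    · rw [abs_of_nonneg hv]
      have hsv : 0 ≤ s * v := by positivity
      have h2 : Real.exp (s * v) - 1 ≤ s * v * Real.exp (s * v) := by
        have h3 := Real.add_one_le_exp (-(s * v))
        rw [Real.exp_neg] at h3
        have h4 := Real.exp_pos (s * v)
        have h5 := mul_le_mul_of_nonneg_right h3 h4.le
        rw [inv_mul_cancel₀ h4.ne'] at h5
        linarith
      have h3 : Real.exp (s * v) ≤ Real.exp p := Real.exp_le_exp.2 h
      nlinarith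
    · rw [abs_of_nonpos hv]
      have hsv : s * v ≤ 0 := mul_nonpos_of_nonneg_of_nonpos hs.le hv
      have h2 : Real.exp (s * v) ≤ 1 := Real.exp_le_one_iff.2 hsv
      nlinarith
  · simp only [abs_zero]; positivity

theorem tendsto_expRemainder (p : ℕ) (v : ℝ) :
    Tendsto (fun s => expRemainder p s v) (𝓝[>] 0) (𝓝 0) := by
  have h1 : Tendsto (fun s : ℝ => s * v ^ 2) (𝓝[>] 0) (𝓝 0) := by
    have : Tendsto (fun s : ℝ => s * v ^ 2) (𝓝 0) (𝓝 (0 * v ^ 2)) :=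
      (continuous_id.mul continuous_const).tendsto 0
    rw [zero_mul] at this
    exact this.mono_left nhdsWithin_le_nhds
  have h2 : ∀ᶠ s : ℝ in 𝓝[>] 0, |s * v| ≤ 1 := by
    have : Tendsto (fun s : ℝ => |s * v|) (𝓝 0) (𝓝 |0 * v|) :=
      (continuous_id.mul continuous_const).abs.tendsto 0
    rw [zero_mul, abs_zero] at this
    exact (this.eventually_le_const one_pos).filter_mono nhdsWithin_le_nhds
  refine squeeze_zero_norm' ?_ h1
  filter_upwards [h2, self_mem_nhdsWithin] with s hs hs0
  have hs0 : 0 < s := hs0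
  rw [Real.norm_eq_abs]
  unfold expRemainder
  split_ifs
  · rw [abs_div, abs_of_pos hs0, div_le_iff₀ hs0]
    calc |Real.exp (s * v) - 1 - s * v| ≤ (s * v) ^ 2 := Real.abs_exp_sub_one_sub_id_le hs
      _ = _ := by ring
  · rw [abs_zero]; positivity

section

variable {Ω : Type*} [MeasurableSpace Ω] {P : Measure Ω}

theorem integrable_expRemainder {X : Ω → ℝ} (hX : Integrable X P) (hXm : Measurable X) (p : ℕ)
    {s : ℝ} (hs : 0 < s) : Integrable (fun ω => expRemainder p s (X ω)) P := by
  refine (hX.abs.const_mul (Real.exp p)).mono'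
    ((measurable_expRemainder p s).comp hXm).aestronglyMeasurable (ae_of_all _ fun ω => ?_)
  exact abs_expRemainder_le hs _

/-- The error after the linear term of the moment generating function is thus o(s), without a second
moment. -/
theorem tendsto_integral_expRemainder {X : Ω → ℝ} (hX : Integrable X P) (hXm : Measurable X)
    (p : ℕ) :
    Tendsto (fun s => ∫ ω, expRemainder p s (X ω) ∂P) (𝓝[>] 0) (𝓝 0) := by
  have := tendsto_integral_filter_of_dominated_convergence (μ := P) (l := 𝓝[>] (0 : ℝ))
    (F := fun s ω => expRemainder p s (X ω)) (f := fun _ => 0)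
    (fun ω => Real.exp p * |X ω|)
    (Eventually.of_forall fun s =>
      ((measurable_expRemainder p s).comp hXm).aestronglyMeasurable)
    (by
      filter_upwards [self_mem_nhdsWithin] with s hs
      exact ae_of_all _ fun ω => abs_expRemainder_le hs _)
    (hX.abs.const_mul _) (ae_of_all _ fun ω => tendsto_expRemainder p _)
  simpa using this

variable [IsProbabilityMeasure P]

theorem integrable_exp_mul_min {X : Ω → ℝ} (hXm : Measurable X) {s : ℝ} (hs : 0 ≤ s) (y : ℝ) :
    Integrable (fun ω => Real.exp (s * min (X ω) y)) P := by
  refine Integrable.of_bound (C := Real.exp (s * y)) (by fun_prop) (ae_of_all _ fun ω => ?_)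
  rw [Real.norm_of_nonneg (Real.exp_pos _).le]
  exact Real.exp_le_exp.2 (mul_le_mul_of_nonneg_left (min_le_right _ _) hs)

/-- The moment generating function of a random variable truncated from above. -/
theorem mgf_min_le {X : Ω → ℝ} (hX : Integrable X P) (hXm : Measurable X) {p : ℕ} {s y : ℝ}
    (hs : 0 < s) (hy : 0 < y) (hsy : p ≤ s * y) :
    mgf (fun ω => min (X ω) y) P s ≤ 1 + s * (∫ ω, X ω ∂P) +
      s * (∫ ω, expRemainder p s (X ω) ∂P) +
      Real.exp (s * y) * ((∫ ω, (min (max (X ω) 0) y) ^ p ∂P) / y ^ p) := by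
  have hpow : Integrable (fun ω => (min (max (X ω) 0) y / y) ^ p) P := by
    refine Integrable.of_bound (C := 1) (by fun_prop) (ae_of_all _ fun ω => ?_)
    have h0 : 0 ≤ min (max (X ω) 0) y := le_min (le_max_right _ _) hy.le
    rw [Real.norm_of_nonneg (by positivity)]
    exact pow_le_one₀ (by positivity) ((div_le_one hy).2 (min_le_right _ _))
  have hrem := integrable_expRemainder hX hXm p hs
  have h1 : mgf (fun ω => min (X ω) y) P s ≤ ∫ ω, (1 + s * X ω + s * expRemainder p s (X ω) +
      Real.exp (s * y) * (min (max (X ω) 0) y / y) ^ p) ∂P := by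
    refine integral_mono (integrable_exp_mul_min hXm hs.le y)
      ((((integrable_const _).add (hX.const_mul s)).add (hrem.const_mul s)).add
        (hpow.const_mul _)) fun ω => ?_
    refine (exp_mul_min_le hs hy hsy (X ω)).trans ?_
    have : s * min (X ω) y ≤ s * X ω := mul_le_mul_of_nonneg_left (min_le_left _ _) hs.le
    linarith
  refine h1.trans (le_of_eq ?_)
  have i1 : Integrable (fun ω => 1 + s * X ω) P := (integrable_const _).add (hX.const_mul s)
  have i2 : Integrable (fun ω => 1 + s * X ω + s * expRemainder p s (X ω)) P :=
    i1.add (hrem.const_mul s)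
  rw [integral_add i2 (hpow.const_mul _), integral_add i1 (hrem.const_mul s),
    integral_add (integrable_const _) (hX.const_mul s)]
  simp only [integral_const_mul, integral_const, probReal_univ, smul_eq_mul, one_mul, div_pow,
    integral_div]

variable {G : ℝ → ℝ} {α : ℝ}

/-- A Fuk–Nagaev type bound: in the range where the mean of the sum stays well below the level
`x`, the tail of a sum of `n` i.i.d. terms is at most a constant times `n * G x`. -/
theorem exists_tail_sum_le (hG : RegVarTail G α) (hG1 : Tendsto (fun x => x * G x) atTop (𝓝 0))
    {X : ℕ → Ω → ℝ} (hXm : ∀ i, Measurable (X i)) (hind : iIndepFun X P)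
    (hid : ∀ i, IdentDistrib (X i) (X 0) P P) (hX : Integrable (X 0) P)
    {K : ℝ} (hK : 0 < K) (hXG : ∀ x, tail P (X 0) x ≤ K * G x)
    {θ : ℝ} (hθ : 0 < θ) (hμ : ∫ ω, X 0 ω ∂P < θ) :
    ∃ C : ℝ, 0 ≤ C ∧ ∀ᶠ x in atTop, ∀ n : ℕ, n * θ ≤ x →
      tail P (fun ω => ∑ i ∈ Finset.range n, X i ω) x ≤ C * n * G x := by
  set μ := ∫ ω, X 0 ω ∂P with hμdef
  -- The gap between μ and m absorbs the remainder term. The gap between m and θ yields δ, with nm ≤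
  -- (1 - δ)x whenever nθ ≤ x.
  obtain ⟨m, hm1, hm2⟩ := exists_between (max_lt hμ hθ)
  have hμm : μ < m := (le_max_left _ _).trans_lt hm1
  have hm0 : 0 < m := (le_max_right _ _).trans_lt hm1
  obtain ⟨δ, hδ⟩ : ∃ δ : ℝ, δ = 1 - m / θ := ⟨_, rfl⟩
  have hδ0 : 0 < δ := by rw [hδ, sub_pos, div_lt_one hθ]; exact hm2
  obtain ⟨A, hA, hGA⟩ := hG.exists_scale_le hδ0
  obtain ⟨p, B, hB, hmom⟩ := exists_truncated_moment_le hG (hXm 0) hK hXG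
  obtain ⟨s₀, hs₀, hrem⟩ : ∃ s₀ : ℝ, 0 < s₀ ∧ ∀ s, 0 < s → s < s₀ →
      ∫ ω, expRemainder p s (X 0 ω) ∂P ≤ m - μ := by
    have h := (tendsto_integral_expRemainder hX (hXm 0) p).eventually_le_const (sub_pos.2 hμm)
    obtain ⟨s₀, hs₀, h'⟩ := mem_nhdsGT_iff_exists_Ioo_subset.1 h
    exact ⟨s₀, hs₀, fun s h1 h2 => h' ⟨h1, h2⟩⟩
  refine ⟨K * A + Real.exp (B * A), by positivity, ?_⟩
  -- This forces nG(x) ≤ xG(x)/θ < exp(-(p + 1)), hence sy > p + 1 as `mgf_min_le` requires. The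
  -- next condition keeps s below s₀.
  have hev1 : ∀ᶠ x in atTop, x * G x < θ * Real.exp (-(p + 1)) :=
    hG1.eventually_lt_const (by positivity)
  have hev2 : ∀ᶠ x in atTop, Real.log (1 / G x) / x < s₀ * δ :=
    hG.tendsto_log_div.eventually_lt_const (by positivity)
  filter_upwards [hev1, hev2, eventually_gt_atTop 0] with x hx1 hx2 hx0 n hn
  have hGx := hG.pos x
  rcases Nat.eq_zero_or_pos n with rfl | hn0
  · simp [tail, hx0.not_gt]
  have hn1 : (1 : ℝ) ≤ n := by exact_mod_cast hn0
  have hn0' : (0 : ℝ) < n := by linarith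
  obtain ⟨l, hl⟩ : ∃ l : ℝ, l = n * G x := ⟨_, rfl⟩
  have hl0 : 0 < l := by rw [hl]; positivity
  have hl1 : l < Real.exp (-(p + 1)) := by
    have : n * G x * θ ≤ x * G x := by nlinarith
    rw [hl]
    exact lt_of_mul_lt_mul_left (by linarith) hθ.le
  have hlog : p + 1 < Real.log (1 / l) := by
    rw [Real.lt_log_iff_exp_lt (by positivity), lt_div_iff₀ hl0]
    calc Real.exp (p + 1) * l < Real.exp (p + 1) * Real.exp (-(p + 1)) := by gcongr
      _ = 1 := by rw [← Real.exp_add]; simp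
  obtain ⟨y, hy⟩ : ∃ y : ℝ, y = δ * x := ⟨_, rfl⟩
  have hy0 : 0 < y := by rw [hy]; positivity
  -- Chosen so that exp(sy) = 1 / (n G x). The truncated-moment term is then at most BA / n, whose
  -- effect over n factors is bounded by exp(BA), while a factor exp(-sy) = n G x survives.
  obtain ⟨s, hs⟩ : ∃ s : ℝ, s = Real.log (1 / l) / y := ⟨_, rfl⟩
  have hpnn : (0 : ℝ) ≤ p := p.cast_nonneg
  have hs0 : 0 < s := by rw [hs]; exact div_pos (by linarith) hy0
  have hsy : s * y = Real.log (1 / l) := by rw [hs]; field_simp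
  have hss₀ : s < s₀ := by
    have h1 : Real.log (1 / l) ≤ Real.log (1 / G x) := by
      refine Real.log_le_log (by positivity) (one_div_le_one_div_of_le hGx ?_)
      rw [hl]; nlinarith
    rw [hs, div_lt_iff₀ hy0, hy]
    rw [div_lt_iff₀ hx0] at hx2
    linarith
  have hesy : Real.exp (s * y) = 1 / l := by rw [hsy, Real.exp_log (by positivity)]
  -- the truncated sum
  set Y : ℕ → Ω → ℝ := fun i ω => min (X i ω) y with hY
  have hYm : ∀ i, Measurable (Y i) := fun i => (hXm i).min measurable_const
  have hYind : iIndepFun Y P :=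
    hind.comp (fun _ v => min v y) (fun _ => measurable_id.min measurable_const)
  have hYid : ∀ i, IdentDistrib (Y i) (Y 0) P P := fun i =>
    (hid i).comp (measurable_id.min measurable_const)
  have hmgf : mgf (Y 0) P s ≤ Real.exp (s * m + B * A / n) := by
    have h1 := mgf_min_le hX (hXm 0) hs0 hy0 (p := p) (by linarith)
    have h2 := hrem s hs0 hss₀
    have h3 : (∫ ω, (min (max (X 0 ω) 0) y) ^ p ∂P) / y ^ p ≤ B * (A * G x) := by
      rw [div_le_iff₀ (by positivity)]
      calc _ ≤ B * y ^ p * G y := hmom y hy0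
        _ ≤ B * y ^ p * (A * G x) := by
          rw [hy] at *
          gcongr
          exact hGA x
        _ = _ := by ring
    have h4 : Real.exp (s * y) * ((∫ ω, (min (max (X 0 ω) 0) y) ^ p ∂P) / y ^ p) ≤ B * A / n := by
      rw [hesy]
      calc _ ≤ 1 / l * (B * (A * G x)) := by gcongr
        _ = B * A / n := by rw [hl]; field_simp
    have h5 : s * (∫ ω, expRemainder p s (X 0 ω) ∂P) ≤ s * (m - μ) := by gcongr
    have h6 := Real.add_one_le_exp (s * m + B * A / n)
    rw [← hμdef] at h1
    calc mgf (Y 0) P s ≤ _ := h1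
      _ ≤ s * m + B * A / n + 1 := by linarith
      _ ≤ _ := h6
  have hsum : P.real {ω | x ≤ (∑ i ∈ Finset.range n, Y i) ω} ≤ Real.exp (B * A) * l := by
    have hint : Integrable (fun ω => Real.exp (s * (∑ i ∈ Finset.range n, Y i) ω)) P :=
      hYind.integrable_exp_mul_sum hYm fun i _ => integrable_exp_mul_min (hXm i) hs0.le y
    refine (measure_ge_le_exp_mul_mgf x hs0.le hint).trans ?_
    rw [hYind.mgf_sum hYm]
    have h1 : ∏ i ∈ Finset.range n, mgf (Y i) P s = mgf (Y 0) P s ^ n := by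
      rw [Finset.prod_congr rfl fun i _ => mgf_congr_of_identDistrib _ _ (hYid i) s]
      simp
    rw [h1]
    have h2 : mgf (Y 0) P s ^ n ≤ Real.exp (n * (s * m) + B * A) := by
      calc mgf (Y 0) P s ^ n ≤ Real.exp (s * m + B * A / n) ^ n :=
            pow_le_pow_left₀ mgf_nonneg hmgf n
        _ = _ := by rw [← Real.exp_nat_mul]; congr 1; field_simp
    have h3 : n * m ≤ (1 - δ) * x := by
      rw [hδ, sub_sub_cancel]
      calc n * m = m / θ * (n * θ) := by field_simp
        _ ≤ m / θ * x := by gcongr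
    calc Real.exp (-s * x) * mgf (Y 0) P s ^ n
        ≤ Real.exp (-s * x) * Real.exp (n * (s * m) + B * A) := by gcongr
      _ = Real.exp (-s * x + s * (n * m) + B * A) := by rw [← Real.exp_add]; congr 1; ring
      _ ≤ Real.exp (-s * x + s * ((1 - δ) * x) + B * A) := by gcongr
      _ = Real.exp (B * A + -(s * y)) := by rw [hy]; congr 1; ring
      _ = Real.exp (B * A) * l := by
        rw [Real.exp_add, Real.exp_neg, hesy, one_div, inv_inv]
  -- Either some term exceeds the truncation level, or the sum agrees with its truncated version.
  have hcover : {ω | x < ∑ i ∈ Finset.range n, X i ω} ⊆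
      (⋃ i ∈ Finset.range n, {ω | y < X i ω}) ∪ {ω | x ≤ (∑ i ∈ Finset.range n, Y i) ω} := by
    intro ω hω
    by_cases h : ∃ i ∈ Finset.range n, y < X i ω
    · obtain ⟨i, hi, hiy⟩ := h
      exact Or.inl (Set.mem_biUnion hi hiy)
    · push Not at h
      refine Or.inr ?_
      have hω : x < ∑ i ∈ Finset.range n, X i ω := hω
      have h1 : (∑ i ∈ Finset.range n, Y i) ω = ∑ i ∈ Finset.range n, X i ω := by
        rw [Finset.sum_apply]
        exact Finset.sum_congr rfl fun i hi => min_eq_left (h i hi)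
      change x ≤ (∑ i ∈ Finset.range n, Y i) ω
      rw [h1]
      exact hω.le
  have hbig : P.real (⋃ i ∈ Finset.range n, {ω | y < X i ω}) ≤ n * (K * (A * G x)) := by
    refine (measureReal_biUnion_finset_le _ _).trans ?_
    have h1 (i : ℕ) : P.real {ω | y < X i ω} ≤ K * (A * G x) := by
      have h2 : P.real {ω | y < X i ω} = P.real {ω | y < X 0 ω} := by
        simp only [measureReal_def]
        congr 1
        exact (hid i).measure_mem_eq measurableSet_Ioi
      rw [h2, hy]
      exact (hXG _).trans (mul_le_mul_of_nonneg_left (hGA x) hK.le)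
    calc _ ≤ ∑ i ∈ Finset.range n, K * (A * G x) := Finset.sum_le_sum fun i _ => h1 i
      _ = _ := by simp
  calc tail P (fun ω => ∑ i ∈ Finset.range n, X i ω) x
      ≤ P.real (⋃ i ∈ Finset.range n, {ω | y < X i ω}) +
        P.real {ω | x ≤ (∑ i ∈ Finset.range n, Y i) ω} :=
        (measureReal_mono hcover).trans (measureReal_union_le _ _)
    _ ≤ n * (K * (A * G x)) + Real.exp (B * A) * l := add_le_add hbig hsum
    _ = _ := by rw [hl]; ring

end

/-! ### Tails of sums with a fixed and with a random number of terms. -/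

section

variable {Ω : Type*} [MeasurableSpace Ω] {P : Measure Ω} [IsProbabilityMeasure P]
  {G : ℝ → ℝ} {α : ℝ}

theorem tail_eq_one_sub {X : Ω → ℝ} (hX : Measurable X) (x : ℝ) :
    tail P X x = 1 - P.real {ω | X ω ≤ x} := by
  have h : {ω | x < X ω} = {ω | X ω ≤ x}ᶜ := by ext; simp
  rw [tail, h, probReal_compl_eq_one_sub (measurableSet_le hX measurable_const)]

theorem tail_tendsto_atBot {X : Ω → ℝ} (hX : Measurable X) :
    Tendsto (tail P X) atBot (𝓝 1) := by
  have : IsProbabilityMeasure (P.map X) := Measure.isProbabilityMeasure_map hX.aemeasurable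
  have h := (tendsto_cdf_atBot (P.map X)).const_sub 1
  rw [sub_zero] at h
  refine h.congr fun x => ?_
  rw [cdf_eq_real, map_measureReal_apply hX measurableSet_Iic, tail_eq_one_sub hX]
  rfl

/-- The tail of a sum of two independent variables with regularly varying (or lighter) tails. -/
theorem tendsto_tail_add (hG : RegVarTail G α) (hG0 : Tendsto G atTop (𝓝 0))
    {X Y : Ω → ℝ} (hX : Measurable X) (hY : Measurable Y) (hXY : IndepFun X Y P) {κ κ' : ℝ}
    (hXG : Tendsto (fun x => tail P X x / G x) atTop (𝓝 κ))
    (hYG : Tendsto (fun x => tail P Y x / G x) atTop (𝓝 κ')) :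
    Tendsto (fun x => tail P (fun ω => X ω + Y ω) x / G x) atTop (𝓝 (κ + κ')) := by
  have hsX (r : ℝ) (hr : 0 < r) :
      Tendsto (fun x => tail P X (r * x) / G x) atTop (𝓝 (κ * r ^ (-α))) := by
    simpa using hG.tendsto_of_scale (tail_antitone X) hXG hr 0
  have hsY (r : ℝ) (hr : 0 < r) :
      Tendsto (fun x => tail P Y (r * x) / G x) atTop (𝓝 (κ' * r ^ (-α))) := by
    simpa using hG.tendsto_of_scale (tail_antitone Y) hYG hr 0
  have hY0 : Tendsto (tail P Y) atTop (𝓝 0) := by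
    have := hYG.mul hG0
    rw [mul_zero] at this
    refine this.congr fun x => ?_
    have := (hG.pos x).ne'
    field_simp
  have hscale (r : ℝ) (hr : 0 < r) : Tendsto (fun x : ℝ => r * x) atTop atTop :=
    tendsto_id.const_mul_atTop hr
  have hprod (a b : ℝ) : P.real ({ω | a < X ω} ∩ {ω | b < Y ω}) = tail P X a * tail P Y b := by
    have := hXY.measure_inter_preimage_eq_mul (Set.Ioi a) (Set.Ioi b) measurableSet_Ioi
      measurableSet_Ioi
    simp only [tail, measureReal_def, ← ENNReal.toReal_mul]
    exact congrArg ENNReal.toReal this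
  have hc : ContinuousAt (fun r : ℝ => (κ + κ') * r ^ (-α)) 1 :=
    continuousAt_const.mul (Real.continuousAt_rpow_const _ _ (Or.inl one_ne_zero))
  have hc1 : (κ + κ') * (1 : ℝ) ^ (-α) = κ + κ' := by rw [Real.one_rpow, mul_one]
  rw [tendsto_order]
  constructor
  · intro b hb
    rw [← hc1] at hb
    have h1 : ∀ᶠ r in 𝓝[>] (1 : ℝ), b < (κ + κ') * r ^ (-α) :=
      (hc.eventually (lt_mem_nhds hb)).filter_mono nhdsWithin_le_nhds
    obtain ⟨r, hr, hr1⟩ := (h1.and self_mem_nhdsWithin).exists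
    have hr1 : 1 < r := hr1
    have hr0 : 0 < r := by linarith
    have hbot : Tendsto (fun x : ℝ => -((r - 1) * x)) atTop atBot :=
      tendsto_neg_atTop_atBot.comp (hscale (r - 1) (by linarith))
    have hlim := (((hsX r hr0).mul ((tail_tendsto_atBot (P := P) hY).comp hbot)).add
      ((hsY r hr0).mul ((tail_tendsto_atBot (P := P) hX).comp hbot))).sub
      ((hsX r hr0).mul (hY0.comp (hscale r hr0)))
    have hval : κ * r ^ (-α) * 1 + κ' * r ^ (-α) * 1 - κ * r ^ (-α) * 0 =
      (κ + κ') * r ^ (-α) := by ring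
    rw [hval] at hlim
    filter_upwards [hlim.eventually_const_lt hr, eventually_ge_atTop 0] with x hx hx0
    refine hx.trans_le ?_
    have hGx := hG.pos x
    rw [le_div_iff₀ hGx]
    -- One term beyond rx while the other is not too negative already forces the sum past x. The
    -- overlap of the two events costs a product of tails, which is o(G).
    set S := {ω | r * x < X ω} ∩ {ω | -((r - 1) * x) < Y ω} with hS
    set T := {ω | -((r - 1) * x) < X ω} ∩ {ω | r * x < Y ω} with hT
    have hTm : MeasurableSet T :=
      (measurableSet_lt measurable_const hX).inter (measurableSet_lt measurable_const hY)
    have h2 : P.real (S ∪ T) ≤ tail P (fun ω => X ω + Y ω) x := by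
      refine measureReal_mono ?_
      rintro ω (⟨h, h'⟩ | ⟨h, h'⟩) <;> simp only [Set.mem_ofPred_eq] at h h' ⊢ <;> linarith
    have h3 : P.real (S ∩ T) ≤ tail P X (r * x) * tail P Y (r * x) := by
      rw [← hprod]
      exact measureReal_mono fun ω hω => ⟨hω.1.1, hω.2.2⟩
    have h4 := measureReal_union_add_inter (μ := P) (s := S) hTm
    rw [hS, hT, hprod, hprod, ← hS, ← hT] at h4
    simp only [Function.comp]
    calc _ = tail P X (r * x) * tail P Y (-((r - 1) * x)) +
          tail P X (-((r - 1) * x)) * tail P Y (r * x) -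
          tail P X (r * x) * tail P Y (r * x) := by field_simp
      _ ≤ _ := by linarith
  · intro b hb
    rw [← hc1] at hb
    have h1 : ∀ᶠ r in 𝓝[<] (1 : ℝ), (κ + κ') * r ^ (-α) < b ∧ 0 < r :=
      ((hc.eventually (gt_mem_nhds hb)).and (lt_mem_nhds one_pos)).filter_mono nhdsWithin_le_nhds
    obtain ⟨r, ⟨hr, hr0⟩, hr1⟩ := (h1.and self_mem_nhdsWithin).exists
    have hr1 : r < 1 := hr1
    have hr1' : 0 < 1 - r := by linarith
    have hlim := ((hsX r hr0).add (hsY r hr0)).add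
      ((hsX (1 - r) hr1').mul (hY0.comp (hscale (1 - r) hr1')))
    have hval : κ * r ^ (-α) + κ' * r ^ (-α) + κ * (1 - r) ^ (-α) * 0 =
      (κ + κ') * r ^ (-α) := by ring
    rw [hval] at hlim
    filter_upwards [hlim.eventually_lt_const hr] with x hx
    refine lt_of_le_of_lt ?_ hx
    have hGx := hG.pos x
    rw [div_le_iff₀ hGx]
    -- If neither term exceeds rx, both must exceed (1 - r)x, and by independence this has
    -- probability o(G).
    have hcover : {ω | x < X ω + Y ω} ⊆ ({ω | r * x < X ω} ∪ {ω | r * x < Y ω}) ∪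
        ({ω | (1 - r) * x < X ω} ∩ {ω | (1 - r) * x < Y ω}) := by
      intro ω hω
      have hω : x < X ω + Y ω := hω
      by_cases h1 : r * x < X ω
      · exact Or.inl (Or.inl h1)
      by_cases h2 : r * x < Y ω
      · exact Or.inl (Or.inr h2)
      refine Or.inr ⟨?_, ?_⟩ <;> simp only [Set.mem_ofPred_eq] <;> linarith
    have h2 : tail P (fun ω => X ω + Y ω) x ≤
        (tail P X (r * x) + tail P Y (r * x)) + tail P X ((1 - r) * x) * tail P Y ((1 - r) * x) := by
      rw [← hprod]
      refine ((measureReal_mono hcover).trans (measureReal_union_le _ _)).trans ?_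
      exact add_le_add_left (measureReal_union_le _ _) _
    refine h2.trans (le_of_eq ?_)
    simp only [Function.comp]
    field_simp

omit [IsProbabilityMeasure P] in
theorem tail_eq_of_identDistrib {X Y : Ω → ℝ} (h : IdentDistrib X Y P P) (x : ℝ) :
    tail P X x = tail P Y x := by
  simp only [tail, measureReal_def]
  exact congrArg ENNReal.toReal (h.measure_mem_eq measurableSet_Ioi)

/-- The tail of the sum of a fixed number of i.i.d. variables. -/
theorem tendsto_tail_sum (hG : RegVarTail G α) (hG0 : Tendsto G atTop (𝓝 0))
    {X : ℕ → Ω → ℝ} (hXm : ∀ i, Measurable (X i)) (hind : iIndepFun X P)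
    (hid : ∀ i, IdentDistrib (X i) (X 0) P P) {κ : ℝ}
    (hXG : Tendsto (fun x => tail P (X 0) x / G x) atTop (𝓝 κ)) (n : ℕ) :
    Tendsto (fun x => tail P (fun ω => ∑ i ∈ Finset.range n, X i ω) x / G x) atTop
      (𝓝 (n * κ)) := by
  induction n with
  | zero =>
    rw [Nat.cast_zero, zero_mul]
    refine tendsto_const_nhds.congr' ?_
    filter_upwards [eventually_gt_atTop 0] with x hx
    simp [tail, hx.not_gt]
  | succ n ih =>
    have h1 : IndepFun (fun ω => ∑ i ∈ Finset.range n, X i ω) (X n) P := by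
      have := hind.indepFun_sum_range_succ hXm n
      rwa [show (∑ j ∈ Finset.range n, X j) = fun ω => ∑ i ∈ Finset.range n, X i ω by
        ext; simp] at this
    have h2 : Tendsto (fun x => tail P (X n) x / G x) atTop (𝓝 κ) :=
      hXG.congr fun x => by rw [tail_eq_of_identDistrib (hid n)]
    have h3 := tendsto_tail_add hG hG0
      (Finset.measurable_fun_sum _ fun i _ => hXm i) (hXm n) h1 ih h2
    simp only [Finset.sum_range_succ]
    convert h3 using 2
    push_cast
    ring

/-- The weak law of large numbers, one-sided. -/
theorem tendsto_tail_sum_mul {X : ℕ → Ω → ℝ} (hXm : ∀ i, Measurable (X i)) (hind : iIndepFun X P)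
    (hid : ∀ i, IdentDistrib (X i) (X 0) P P) (hX : Integrable (X 0) P) {θ : ℝ}
    (hθ : θ < ∫ ω, X 0 ω ∂P) :
    Tendsto (fun n : ℕ => tail P (fun ω => ∑ i ∈ Finset.range n, X i ω) (n * θ)) atTop (𝓝 1) := by
  have hm (n : ℕ) : Measurable fun ω => ∑ i ∈ Finset.range n, X i ω :=
    Finset.measurable_fun_sum _ fun i _ => hXm i
  have h1 := tendstoInMeasure_of_tendsto_ae
    (fun n => ((hm n).div_const (n : ℝ)).aestronglyMeasurable)
    (strong_law_ae_real X hX (fun i j hij => hind.indepFun hij) hid)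
  rw [tendstoInMeasure_iff_measureReal_dist] at h1
  have h2 := (h1 _ (sub_pos.2 hθ)).const_sub 1
  rw [sub_zero] at h2
  refine tendsto_of_tendsto_of_tendsto_of_le_of_le' h2 tendsto_const_nhds ?_
    (Eventually.of_forall fun n => tail_le_one _ _)
  filter_upwards [eventually_gt_atTop 0] with n hn
  have hn : (0 : ℝ) < n := by exact_mod_cast hn
  rw [tail_eq_one_sub (hm n)]
  refine sub_le_sub_left (measureReal_mono fun ω hω => ?_) 1
  have hω : ∑ i ∈ Finset.range n, X i ω ≤ n * θ := hω
  have h3 : (∑ i ∈ Finset.range n, X i ω) / n ≤ θ := by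
    rw [div_le_iff₀ hn]; linarith
  simp only [Set.mem_ofPred_eq, Real.dist_eq]
  rw [abs_sub_comm]
  exact le_trans (by linarith) (le_abs_self _)

/-- The tail of a random sum whose number of terms has weights `a` and tail `G`. -/
theorem tendsto_tail_randomSum (hG : RegVarTail G α)
    (hG1 : Tendsto (fun x => x * G x) atTop (𝓝 0))
    {X : ℕ → Ω → ℝ} (hXm : ∀ i, Measurable (X i)) (hind : iIndepFun X P)
    (hid : ∀ i, IdentDistrib (X i) (X 0) P P) (hX : Integrable (X 0) P)
    (hμ : 0 < ∫ ω, X 0 ω ∂P) {κ : ℝ}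
    (hXG : Tendsto (fun x => tail P (X 0) x / G x) atTop (𝓝 κ))
    {a : ℕ → ℝ} (ha : ∀ n, 0 ≤ a n) (ha1 : Summable a) {m : ℝ}
    (ham : HasSum (fun n : ℕ => (n : ℝ) * a n) m)
    (haG : ∀ x, G x = ∑' n : ℕ, if x < n then a n else 0) :
    Tendsto (fun x => (∑' n : ℕ, a n * tail P (fun ω => ∑ i ∈ Finset.range n, X i ω) x) / G x)
      atTop (𝓝 ((∫ ω, X 0 ω ∂P) ^ α + m * κ)) := by
  set μ := ∫ ω, X 0 ω ∂P with hμdef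
  set T : ℕ → ℝ → ℝ := fun n x => tail P (fun ω => ∑ i ∈ Finset.range n, X i ω) x with hT
  have hT0 : ∀ n x, 0 ≤ T n x := fun n x => tail_nonneg _ _
  have hT1 : ∀ n x, T n x ≤ 1 := fun n x => tail_le_one _ _
  have hG0 : Tendsto G atTop (𝓝 0) := by
    refine tendsto_of_tendsto_of_tendsto_of_le_of_le' tendsto_const_nhds hG1
      (Eventually.of_forall fun x => (hG.pos x).le) ?_
    filter_upwards [eventually_ge_atTop 1] with x hx
    have := hG.pos x
    nlinarith
  obtain ⟨K, hK, hKG⟩ := hG.exists_le_mul_of_tendsto (tail_le_one (P := P) (X 0)) hXG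
  have hsum_of_le {f : ℕ → ℝ} (h0 : ∀ n, 0 ≤ f n) (h1 : ∀ n, f n ≤ a n) : Summable f :=
    Summable.of_nonneg_of_le h0 h1 ha1
  have haT0 (n : ℕ) (x : ℝ) : 0 ≤ a n * T n x := mul_nonneg (ha n) (hT0 n x)
  have haT1 (n : ℕ) (x : ℝ) : a n * T n x ≤ a n := mul_le_of_le_one_right (ha n) (hT1 n x)
  -- The single-big-jump part. For each n the cutoff is eventually inactive, and the uniform bound
  -- supplies the majorant C n a_n. The limit does not depend on θ.
  have hsmall (θ : ℝ) (hθ : μ < θ) :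
      Tendsto (fun x => (∑' n : ℕ, if n * θ ≤ x then a n * T n x else 0) / G x) atTop
        (𝓝 (m * κ)) := by
    have hθ0 : 0 < θ := hμ.trans hθ
    obtain ⟨C, hC, hbound⟩ := exists_tail_sum_le hG hG1 hXm hind hid hX hK hKG hθ0 hθ
    have hlim : ∑' n : ℕ, a n * (n * κ) = m * κ := by
      rw [← ham.tsum_eq, ← tsum_mul_right]
      exact tsum_congr fun n => by ring
    rw [← hlim]
    simp_rw [← tsum_div_const]
    refine tendsto_tsum_of_dominated_convergence (bound := fun n => C * (n * a n))
      (ham.summable.mul_left C) ?_ ?_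
    · intro n
      refine ((tendsto_tail_sum hG hG0 hXm hind hid hXG n).const_mul (a n)).congr' ?_
      filter_upwards [eventually_ge_atTop (n * θ)] with x hx
      rw [if_pos hx, mul_div_assoc]
    · filter_upwards [hbound] with x hx n
      have hGx := hG.pos x
      split_ifs with h
      · rw [Real.norm_of_nonneg (div_nonneg (haT0 n x) hGx.le), div_le_iff₀ hGx]
        calc a n * T n x ≤ a n * (C * n * G x) := mul_le_mul_of_nonneg_left (hx n h) (ha n)
          _ = _ := by ring
      · rw [zero_div, norm_zero]
        have := ha n
        positivity
  have hsplit (θ x : ℝ) : ∑' n : ℕ, a n * T n x =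
      (∑' n : ℕ, if n * θ ≤ x then a n * T n x else 0) +
      ∑' n : ℕ, if n * θ ≤ x then 0 else a n * T n x := by
    rw [← Summable.tsum_add]
    · refine tsum_congr fun n => ?_
      split_ifs <;> simp
    · refine hsum_of_le (fun n => ?_) (fun n => ?_) <;> split_ifs
      exacts [haT0 n x, le_rfl, haT1 n x, ha n]
    · refine hsum_of_le (fun n => ?_) (fun n => ?_) <;> split_ifs
      exacts [le_rfl, haT0 n x, ha n, haT1 n x]
  have hGθ (θ : ℝ) (hθ : 0 < θ) :
      Tendsto (fun x => G (θ⁻¹ * x) / G x) atTop (𝓝 (θ ^ α)) := by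
    have := hG.ratio θ⁻¹ (inv_pos.2 hθ)
    rwa [Real.inv_rpow hθ.le, Real.rpow_neg hθ.le, inv_inv] at this
  rw [tendsto_order]
  constructor
  · intro b hb
    -- One parameter r < 1 serves twice: as a lower bound for the probability from the law of large
    -- numbers, and to lower the mean to rμ. Indices n > x/(rμ) contribute at least r G(x/(rμ)) and
    -- are disjoint from those with n(μ + 1) ≤ x.
    have hc : ContinuousAt (fun r : ℝ => r * (r * μ) ^ α + m * κ) 1 := by
      refine (continuousAt_id.mul (ContinuousAt.rpow_const
        (continuousAt_id.mul continuousAt_const) (Or.inl ?_))).add continuousAt_const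
      simpa using hμ.ne'
    have hb' : b < (fun r : ℝ => r * (r * μ) ^ α + m * κ) 1 := by simpa using hb
    have h1 : ∀ᶠ r in 𝓝[<] (1 : ℝ), b < r * (r * μ) ^ α + m * κ ∧ 0 < r :=
      ((hc.eventually (lt_mem_nhds hb')).and (lt_mem_nhds one_pos)).filter_mono nhdsWithin_le_nhds
    obtain ⟨r, ⟨hr, hr0⟩, hr1⟩ := (h1.and self_mem_nhdsWithin).exists
    have hr1 : r < 1 := hr1
    have hrμ : 0 < r * μ := mul_pos hr0 hμ
    have hrμ' : r * μ < μ := by nlinarith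
    have hlim := ((hGθ (r * μ) hrμ).const_mul r).add (hsmall (μ + 1) (by linarith))
    obtain ⟨n₀, hn₀⟩ := eventually_atTop.1
      ((tendsto_tail_sum_mul hXm hind hid hX hrμ').eventually_const_le hr1)
    filter_upwards [hlim.eventually_const_lt hr, eventually_ge_atTop (r * μ * n₀),
      eventually_ge_atTop 0] with x hx hxn hx0
    refine hx.trans_le ?_
    rw [hsplit (μ + 1) x, add_div, ← mul_div_assoc, add_comm]
    refine add_le_add_right (div_le_div_of_nonneg_right ?_ (hG.pos x).le) _
    rw [haG, ← tsum_mul_left]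
    refine Summable.tsum_le_tsum (fun n => ?_) ?_ ?_
    · split_ifs with h2 h3 h3
      · exfalso
        rw [inv_mul_lt_iff₀ hrμ] at h2
        have : (0 : ℝ) ≤ n := n.cast_nonneg
        nlinarith
      · rw [inv_mul_lt_iff₀ hrμ] at h2
        have hn : n₀ ≤ n := by
          have : r * μ * n₀ < r * μ * n := lt_of_le_of_lt hxn h2
          exact_mod_cast (lt_of_mul_lt_mul_left this hrμ.le).le
        have h4 : r ≤ T n x := (hn₀ n hn).trans (tail_antitone _ (by linarith))
        rw [mul_comm]
        exact mul_le_mul_of_nonneg_left h4 (ha n)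
      · simp
      · simpa using haT0 n x
    · refine hsum_of_le (fun n => ?_) (fun n => ?_) <;> split_ifs
      exacts [mul_nonneg hr0.le (ha n), (mul_zero r).ge, mul_le_of_le_one_left (ha n) hr1.le,
        by simpa using ha n]
    · refine hsum_of_le (fun n => ?_) (fun n => ?_) <;> split_ifs
      exacts [le_rfl, haT0 n x, ha n, haT1 n x]
  · intro b hb
    have hc : ContinuousAt (fun θ : ℝ => θ ^ α + m * κ) μ :=
      (Real.continuousAt_rpow_const _ _ (Or.inl hμ.ne')).add continuousAt_const
    -- For nθ > x the tail of the sum is bounded by 1, so these indices contribute at most G(x/θ);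
    -- then θ decreases to μ.
    have h1 : ∀ᶠ θ in 𝓝[>] μ, θ ^ α + m * κ < b :=
      (hc.eventually (gt_mem_nhds hb)).filter_mono nhdsWithin_le_nhds
    obtain ⟨θ, hθ, hθμ⟩ := (h1.and self_mem_nhdsWithin).exists
    have hθμ : μ < θ := hθμ
    have hθ0 : 0 < θ := hμ.trans hθμ
    filter_upwards [((hGθ θ hθ0).add (hsmall θ hθμ)).eventually_lt_const hθ] with x hx
    refine lt_of_le_of_lt ?_ hx
    rw [hsplit θ x, add_div, add_comm]
    refine add_le_add_left (div_le_div_of_nonneg_right ?_ (hG.pos x).le) _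
    rw [haG]
    refine Summable.tsum_le_tsum (fun n => ?_) ?_ ?_
    · simp only [inv_mul_lt_iff₀ hθ0]
      split_ifs with h2 h3 h3
      · exact ha n
      · exact le_rfl
      · exact haT1 n x
      · exact absurd (by linarith) h2
    · refine hsum_of_le (fun n => ?_) (fun n => ?_) <;> split_ifs
      exacts [le_rfl, haT0 n x, ha n, haT1 n x]
    · refine hsum_of_le (fun n => ?_) (fun n => ?_) <;> split_ifs
      exacts [ha n, le_rfl, le_rfl, ha n]

end

/-! ### Independence for pairs of i.i.d. sequences. -/

/-- Functions of the pairs of coordinates of two independent i.i.d. sequences are independent. -/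
theorem iIndepFun_prod_infinitePi {ι E F H : Type*} [MeasurableSpace E] [MeasurableSpace F]
    [MeasurableSpace H] (μ : Measure E) [IsProbabilityMeasure μ] (ν : Measure F)
    [IsProbabilityMeasure ν] {f : E × F → H} (hf : Measurable f) :
    iIndepFun (fun (i : ι) (t : (ι → E) × (ι → F)) => f (t.1 i, t.2 i))
      ((Measure.infinitePi fun _ => μ).prod (Measure.infinitePi fun _ => ν)) := by
  classical
  have hm (i : ι) : Measurable fun t : (ι → E) × (ι → F) => f (t.1 i, t.2 i) := by fun_prop
  -- For a frozen first sequence d the event is a box in the second one, so its measure factors;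
  -- each factor depends on one coordinate d i, and these are independent. The value 0 outside S
  -- secures measurability there, where nothing is assumed on the sets.
  have key (S : Finset ι) (sets : ι → Set H) (hs : ∀ i ∈ S, MeasurableSet (sets i)) :
      ((Measure.infinitePi fun _ => μ).prod (Measure.infinitePi fun _ => ν))
        (⋂ i ∈ S, (fun t : (ι → E) × (ι → F) => f (t.1 i, t.2 i)) ⁻¹' sets i) =
      ∏ i ∈ S, ∫⁻ d, (if i ∈ S then ν (Prod.mk (d i) ⁻¹' (f ⁻¹' sets i)) else 0)
        ∂(Measure.infinitePi fun _ : ι => μ) := by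
    have hg (i : ι) : Measurable fun e : E =>
        if i ∈ S then ν (Prod.mk e ⁻¹' (f ⁻¹' sets i)) else 0 := by
      by_cases hi : i ∈ S
      · simpa only [if_pos hi] using measurable_measure_prodMk_left (hf (hs i hi))
      · simp only [if_neg hi, measurable_const]
    rw [← lintegral_prod_eq_prod_lintegral_of_indepFun S _ (iIndepFun_infinitePi hg)
      (fun i => (hg i).comp (measurable_pi_apply i)),
      Measure.prod_apply (S.measurableSet_biInter fun i hi => hm i (hs i hi))]
    refine lintegral_congr fun d => ?_
    have h1 : Prod.mk d ⁻¹' (⋂ i ∈ S, (fun t : (ι → E) × (ι → F) => f (t.1 i, t.2 i)) ⁻¹' sets i) =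
        (S : Set ι).pi fun i => Prod.mk (d i) ⁻¹' (f ⁻¹' sets i) := by
      ext r; simp
    rw [h1, Measure.infinitePi_pi _ fun i hi => measurable_prodMk_left (hf (hs i hi))]
    exact Finset.prod_congr rfl fun i hi => by rw [if_pos hi]
  rw [iIndepFun_iff_measure_inter_preimage_eq_mul]
  intro S sets hs
  rw [key S sets hs]
  refine Finset.prod_congr rfl fun i hi => ?_
  -- The singleton case identifies each factor as the probability of a single event.
  have := key {i} sets (fun j hj => hs j (by rw [Finset.mem_singleton] at hj; rwa [hj]))
  simp only [Finset.mem_singleton, Set.iInter_iInter_eq_left, Finset.prod_singleton,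
    if_true] at this
  rw [this]
  simp [hi]

theorem measurePreserving_eval_prod_infinitePi {ι E F : Type*} [MeasurableSpace E]
    [MeasurableSpace F] (μ : Measure E) [IsProbabilityMeasure μ] (ν : Measure F)
    [IsProbabilityMeasure ν] (i : ι) :
    MeasurePreserving (fun t : (ι → E) × (ι → F) => (t.1 i, t.2 i))
      ((Measure.infinitePi fun _ => μ).prod (Measure.infinitePi fun _ => ν)) (μ.prod ν) :=
  (measurePreserving_eval_infinitePi (fun _ : ι => μ) i).prod
    (measurePreserving_eval_infinitePi (fun _ : ι => ν) i)

/-! ### Integrals against laws on the natural numbers as series. -/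

section Countable

variable {E : Type*} [MeasurableSpace E]

theorem hasSum_integral_nat {μ : Measure ℕ} [IsFiniteMeasure μ] {f : ℕ → ℝ}
    (hf : Integrable f μ) : HasSum (fun n => μ.real {n} * f n) (∫ n, f n ∂μ) := by
  have hf' : Integrable f (Measure.sum fun n => μ {n} • Measure.dirac n) := by
    rwa [Measure.sum_smul_dirac]
  have h := hasSum_integral_measure hf'
  rw [Measure.sum_smul_dirac] at h
  simpa only [integral_smul_measure, integral_dirac, smul_eq_mul, measureReal_def] using h

theorem prod_measureReal_eq_tsum (μ : Measure ℕ) [IsProbabilityMeasure μ] (ν : Measure E)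
    [IsProbabilityMeasure ν] {s : Set (ℕ × E)} (hs : MeasurableSet s) :
    (μ.prod ν).real s = ∑' n, μ.real {n} * ν.real (Prod.mk n ⁻¹' s) := by
  have hint : Integrable (fun n => ν.real (Prod.mk n ⁻¹' s)) μ :=
    Integrable.of_bound (C := 1) (measurable_of_countable _).aestronglyMeasurable
      (ae_of_all _ fun n => by
        rw [Real.norm_of_nonneg measureReal_nonneg]; exact measureReal_le_one)
  rw [(hasSum_integral_nat hint).tsum_eq, measureReal_def, Measure.prod_apply hs]
  simp only [measureReal_def]
  rw [integral_toReal (measurable_of_countable _).aemeasurable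
    (ae_of_all _ fun n => measure_lt_top _ _)]

theorem measureReal_eq_tsum (μ : Measure ℕ) [IsProbabilityMeasure μ] (x : ℝ) :
    μ.real {n : ℕ | x < n} = ∑' n : ℕ, if x < n then μ.real {n} else 0 := by
  have hs : MeasurableSet {n : ℕ | x < n} := MeasurableSet.of_discrete
  have h := (hasSum_integral_nat (μ := μ)
    ((integrable_const (1 : ℝ)).indicator hs)).tsum_eq
  rw [integral_indicator_const _ hs, smul_eq_mul, mul_one] at h
  rw [← h]
  refine tsum_congr fun n => ?_
  by_cases hn : x < n <;> simp [Set.indicator, hn]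

end Countable

/-! ### Tail of R / D. -/

section Breiman

variable {G : ℝ → ℝ} {α : ℝ}

/-- Multiplication by the reciprocal of an independent positive integer only changes the constant
in front of a regularly varying tail. -/
theorem tendsto_tail_one_div_mul (hG : RegVarTail G α) (lawD : Measure ℕ)
    [IsProbabilityMeasure lawD] (hD0 : lawD.real {0} = 0) (lawR : Measure ℝ)
    [IsProbabilityMeasure lawR] {κ : ℝ}
    (hα : Integrable (fun j : ℕ => 1 / (j : ℝ) ^ α) lawD)
    (hRG : Tendsto (fun x => lawR.real (Set.Ioi x) / G x) atTop (𝓝 κ)) :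
    Tendsto (fun x => tail (lawD.prod lawR) (fun q => 1 / (q.1 : ℝ) * q.2) x / G x) atTop
      (𝓝 (κ * ∫ j, 1 / (j : ℝ) ^ α ∂lawD)) := by
  have hanti : Antitone fun x => lawR.real (Set.Ioi x) := fun a b h =>
    measureReal_mono (Set.Ioi_subset_Ioi h)
  obtain ⟨K, hK, hKG⟩ := hG.exists_le_mul_of_tendsto
    (F := fun x => lawR.real (Set.Ioi x)) (fun x => measureReal_le_one) hRG
  have hlim : ∑' j : ℕ, lawD.real {j} * (κ * (1 / (j : ℝ) ^ α)) =
      κ * ∫ j, 1 / (j : ℝ) ^ α ∂lawD := by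
    rw [← (hasSum_integral_nat hα).tsum_eq, ← tsum_mul_left]
    exact tsum_congr fun j => by ring
  have hsum : Summable fun j : ℕ => K * lawD.real {j} := by
    simpa using ((hasSum_integral_nat (μ := lawD) (integrable_const (1 : ℝ))).summable).mul_left K
  -- Given D = j the level x becomes jx. As j ≥ 1 on the support, K G(x) dominates every tail P(R >
  -- jx), so the limit may be taken termwise.
  have hmain : Tendsto (fun x => ∑' j : ℕ, lawD.real {j} * (lawR.real (Set.Ioi (j * x)) / G x))
      atTop (𝓝 (∑' j : ℕ, lawD.real {j} * (κ * (1 / (j : ℝ) ^ α)))) := by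
    refine tendsto_tsum_of_dominated_convergence hsum (fun j => ?_) ?_
    · rcases Nat.eq_zero_or_pos j with rfl | hj
      · simp [hD0]
      · have hj' : (0 : ℝ) < j := by exact_mod_cast hj
        refine Tendsto.const_mul _ ?_
        have := hG.tendsto_of_scale hanti hRG hj' 0
        rw [Real.rpow_neg hj'.le, ← one_div] at this
        simpa only [add_zero] using this
    · filter_upwards [eventually_ge_atTop 0] with x hx j
      have hGx := hG.pos x
      rcases Nat.eq_zero_or_pos j with rfl | hj
      · simp [hD0]
      · have hj' : (1 : ℝ) ≤ j := by exact_mod_cast hj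
        have h1 : lawR.real (Set.Ioi (j * x)) / G x ≤ K := by
          rw [div_le_iff₀ hGx]
          exact (hanti (by nlinarith)).trans (hKG x)
        rw [Real.norm_of_nonneg (by positivity), mul_comm K]
        gcongr
  rw [← hlim]
  refine hmain.congr' ?_
  filter_upwards [eventually_gt_atTop 0] with x hx
  have hm : Measurable fun q : ℕ × ℝ => 1 / (q.1 : ℝ) * q.2 :=
    (((measurable_from_nat (f := fun m : ℕ => (m : ℝ))).comp measurable_fst).const_div 1).mul
      measurable_snd
  rw [tail, prod_measureReal_eq_tsum lawD lawR (measurableSet_lt measurable_const hm),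
    ← tsum_div_const]
  refine tsum_congr fun j => ?_
  rcases Nat.eq_zero_or_pos j with rfl | hj
  · simp [hD0]
  · have hj' : (0 : ℝ) < j := by exact_mod_cast hj
    have : Prod.mk j ⁻¹' {q : ℕ × ℝ | x < 1 / (q.1 : ℝ) * q.2} = Set.Ioi (j * x) := by
      ext r
      simp only [Set.mem_preimage, Set.mem_ofPred_eq, Set.mem_Ioi]
      rw [one_div, lt_inv_mul_iff₀ hj']
    rw [this, mul_div_assoc]

end Breiman

/-! ### One iteration of the recursion. -/

section Step

variable {G : ℝ → ℝ} {α : ℝ}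

theorem measurable_one_div_mul : Measurable fun q : ℕ × ℝ => 1 / (q.1 : ℝ) * q.2 :=
  (((measurable_from_nat (f := fun m : ℕ => (m : ℝ))).comp measurable_fst).const_div 1).mul
    measurable_snd

/-- One iteration keeps the mean equal to `1` and transforms the tail constant affinely. -/
theorem iterStep_spec (hG : RegVarTail G α) (hG1 : Tendsto (fun x => x * G x) atTop (𝓝 0))
    {c p₀ d : ℝ} (hc : 0 < c) (hd : 0 < d) (hp₀ : p₀ < 1)
    {lawN lawD : ProbabilityMeasure ℕ} {lawR : ProbabilityMeasure ℝ}
    (hGN : ∀ x, G x = (lawN : Measure ℕ).real {n : ℕ | x < n})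
    (hN : Integrable (fun n : ℕ => (n : ℝ)) (lawN : Measure ℕ))
    (hNd : ∫ n : ℕ, (n : ℝ) ∂(lawN : Measure ℕ) = d)
    (hD0 : (lawD : Measure ℕ).real {0} = 0)
    (hD : Integrable (fun j : ℕ => 1 / (j : ℝ)) (lawD : Measure ℕ))
    (hDd : ∫ j : ℕ, 1 / (j : ℝ) ∂(lawD : Measure ℕ) = (1 - p₀) / d)
    (hα : Integrable (fun j : ℕ => 1 / (j : ℝ) ^ α) (lawD : Measure ℕ))
    (hR : Integrable (fun r : ℝ => r) (lawR : Measure ℝ))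
    (hR1 : ∫ r, r ∂(lawR : Measure ℝ) = 1) {κ : ℝ}
    (hRG : Tendsto (fun x => (lawR : Measure ℝ).real (Set.Ioi x) / G x) atTop (𝓝 κ)) :
    Integrable (fun r : ℝ => r) (iterStep c p₀ lawN lawD lawR : Measure ℝ) ∧
    ∫ r, r ∂(iterStep c p₀ lawN lawD lawR : Measure ℝ) = 1 ∧
    Tendsto (fun x => (iterStep c p₀ lawN lawD lawR : Measure ℝ).real (Set.Ioi x) / G x) atTop
      (𝓝 ((((1 - p₀) / d) ^ α + d * (κ * ∫ j : ℕ, 1 / (j : ℝ) ^ α ∂(lawD : Measure ℕ))) *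
        c ^ α)) := by
  set π : Measure ((ℕ → ℕ) × (ℕ → ℝ)) := (Measure.infinitePi fun _ => (lawD : Measure ℕ)).prod
    (Measure.infinitePi fun _ => (lawR : Measure ℝ)) with hπ
  set ρ : Measure (ℕ × ℝ) := (lawD : Measure ℕ).prod (lawR : Measure ℝ) with hρ
  set X : ℕ → (ℕ → ℕ) × (ℕ → ℝ) → ℝ := fun j t => 1 / (t.1 j : ℝ) * t.2 j with hX
  have hmp (i : ℕ) : MeasurePreserving (fun t : (ℕ → ℕ) × (ℕ → ℝ) => (t.1 i, t.2 i)) π ρ :=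
    measurePreserving_eval_prod_infinitePi _ _ i
  have hXm (i : ℕ) : Measurable (X i) := measurable_one_div_mul.comp (hmp i).measurable
  have hind : iIndepFun X π := iIndepFun_prod_infinitePi _ _ measurable_one_div_mul
  have hmap (i : ℕ) : π.map (X i) = ρ.map fun q => 1 / (q.1 : ℝ) * q.2 := by
    rw [← (hmp i).map_eq, Measure.map_map measurable_one_div_mul (hmp i).measurable]
    rfl
  have hid (i : ℕ) : IdentDistrib (X i) (X 0) π π :=
    ⟨(hXm i).aemeasurable, (hXm 0).aemeasurable, by rw [hmap, hmap]⟩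
  have hρint : Integrable (fun q : ℕ × ℝ => 1 / (q.1 : ℝ) * q.2) ρ := hD.mul_prod hR
  have hXint (i : ℕ) : Integrable (X i) π := (hmp i).integrable_comp_of_integrable hρint
  have hXmean (i : ℕ) : ∫ t, X i t ∂π = (1 - p₀) / d := by
    rw [← integral_map (hXm i).aemeasurable (f := fun r => r) measurable_id'.aestronglyMeasurable, hmap,
      integral_map measurable_one_div_mul.aemeasurable measurable_id'.aestronglyMeasurable, hρ,
      integral_prod_mul (fun j : ℕ => 1 / (j : ℝ)) (fun r : ℝ => r), hDd, hR1, mul_one]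
  have hXtail : Tendsto (fun x => tail π (X 0) x / G x) atTop
      (𝓝 (κ * ∫ j : ℕ, 1 / (j : ℝ) ^ α ∂(lawD : Measure ℕ))) := by
    refine (tendsto_tail_one_div_mul hG _ hD0 _ hα hRG).congr fun x => ?_
    congr 1
    simp only [tail, measureReal_def]
    rw [← (hmp 0).measure_preimage
      (measurableSet_lt measurable_const measurable_one_div_mul).nullMeasurableSet]
    rfl
  set a : ℝ := 1 - c * (1 - p₀) with ha
  set S : ℕ → (ℕ → ℕ) × (ℕ → ℝ) → ℝ := fun n t => ∑ j ∈ Finset.range n, X j t with hS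
  have hSint (n : ℕ) : Integrable (S n) π := integrable_finsetSum _ fun i _ => hXint i
  have hlaw : (iterStep c p₀ lawN lawD lawR : Measure ℝ) =
      ((lawN : Measure ℕ).prod π).map (rhs c p₀) := rfl
  have hrm := measurable_rhs c p₀
  have hrhs (n : ℕ) (t : (ℕ → ℕ) × (ℕ → ℝ)) : rhs c p₀ (n, t) = c * S n t + a := rfl
  have hrhsint : Integrable (rhs c p₀) ((lawN : Measure ℕ).prod π) := by
    rw [integrable_prod_iff hrm.aestronglyMeasurable]
    refine ⟨ae_of_all _ fun n => ((hSint n).const_mul c).add (integrable_const a), ?_⟩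
    -- Given N = n, the triangle inequality bounds the absolute mean affinely in n, and N is
    -- integrable.
    refine Integrable.mono' (g := fun n : ℕ => c * ((∫ t, |X 0 t| ∂π) * n) + |a|)
      (((hN.const_mul _).const_mul c).add (integrable_const _))
      (measurable_of_countable _).aestronglyMeasurable (ae_of_all _ fun n => ?_)
    rw [Real.norm_of_nonneg (integral_nonneg fun t => norm_nonneg _)]
    have habs (i : ℕ) : ∫ t, |X i t| ∂π = ∫ t, |X 0 t| ∂π :=
      ((hid i).comp measurable_norm).integral_eq
    have hsum : Integrable (fun t => ∑ j ∈ Finset.range n, |X j t|) π :=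
      integrable_finsetSum _ fun i _ => (hXint i).abs
    calc ∫ t, ‖rhs c p₀ (n, t)‖ ∂π ≤ ∫ t, (c * ∑ j ∈ Finset.range n, |X j t| + |a|) ∂π := by
          refine integral_mono (((hSint n).const_mul c).add (integrable_const a)).norm
            ((hsum.const_mul c).add (integrable_const _)) fun t => ?_
          dsimp only
          rw [hrhs, Real.norm_eq_abs]
          refine (abs_add_le _ _).trans (add_le_add_left ?_ _)
          rw [abs_mul, abs_of_pos hc]
          exact mul_le_mul_of_nonneg_left (Finset.abs_sum_le_sum_abs _ _) hc.le
      _ = c * ((∫ t, |X 0 t| ∂π) * n) + |a| := by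
          rw [integral_add (hsum.const_mul c) (integrable_const _), integral_const_mul,
            integral_finsetSum _ fun i _ => (hXint i).abs]
          simp only [habs]
          simp [mul_comm]
  refine ⟨?_, ?_, ?_⟩
  · rw [hlaw, integrable_map_measure measurable_id'.aestronglyMeasurable hrm.aemeasurable]
    exact hrhsint
  · rw [hlaw, integral_map hrm.aemeasurable measurable_id'.aestronglyMeasurable, integral_prod _ hrhsint]
    have h1 (n : ℕ) : ∫ t, rhs c p₀ (n, t) ∂π = c * ((1 - p₀) / d * n) + a := by
      simp only [hrhs]
      rw [integral_add ((hSint n).const_mul c) (integrable_const _), integral_const_mul,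
        integral_finsetSum _ fun i _ => hXint i]
      simp only [hXmean]
      simp [mul_comm]
    simp only [h1]
    rw [integral_add ((hN.const_mul _).const_mul c) (integrable_const _), integral_const_mul,
      integral_const_mul, hNd]
    simp only [integral_const, probReal_univ, smul_eq_mul, one_mul]
    rw [ha]
    field_simp
    ring
  · have hmean : 0 < ∫ t, X 0 t ∂π := by
      rw [hXmean]; exact div_pos (by linarith) hd
    have hNsum : HasSum (fun n : ℕ => (n : ℝ) * (lawN : Measure ℕ).real {n}) d := by
      have := hasSum_integral_nat hN
      rw [hNd] at this
      simpa only [mul_comm] using this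
    have hN1 : Summable fun n : ℕ => (lawN : Measure ℕ).real {n} := by
      simpa using (hasSum_integral_nat (μ := (lawN : Measure ℕ))
        (integrable_const (1 : ℝ))).summable
    have hmain := tendsto_tail_randomSum hG hG1 hXm hind hid (hXint 0) hmean hXtail
      (fun n => measureReal_nonneg) hN1 hNsum
      (fun x => by rw [hGN, measureReal_eq_tsum])
    rw [hXmean] at hmain
    set F : ℝ → ℝ := fun x => ∑' n : ℕ, (lawN : Measure ℕ).real {n} * tail π (S n) x with hF
    have hFs (x : ℝ) : Summable fun n : ℕ => (lawN : Measure ℕ).real {n} * tail π (S n) x :=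
      Summable.of_nonneg_of_le (fun n => mul_nonneg measureReal_nonneg (tail_nonneg _ _))
        (fun n => mul_le_of_le_one_right measureReal_nonneg (tail_le_one _ _)) hN1
    have hFanti : Antitone F := fun x y hxy =>
      Summable.tsum_le_tsum (fun n =>
        mul_le_mul_of_nonneg_left (tail_antitone _ hxy) measureReal_nonneg) (hFs y) (hFs x)
    -- The event cS + a > x is S > x/c - a/c: an asymptotically linear change of level, which
    -- produces the factor c^α.
    have h2 := hG.tendsto_of_scale hFanti hmain (inv_pos.2 hc) (-a / c)
    rw [Real.inv_rpow hc.le, Real.rpow_neg hc.le, inv_inv] at h2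
    refine h2.congr fun x => ?_
    congr 1
    rw [hlaw, map_measureReal_apply hrm measurableSet_Ioi,
      prod_measureReal_eq_tsum _ _ (hrm measurableSet_Ioi)]
    refine tsum_congr fun n => ?_
    congr 1
    simp only [tail]
    congr 1
    ext t
    simp only [Set.mem_preimage, Set.mem_ofPred_eq, Set.mem_Ioi, hrhs]
    rw [show c⁻¹ * x + -a / c = (x - a) / c by field_simp; ring, div_lt_iff₀ hc]
    constructor <;> intro h <;> linarith

end Step

/-! ### From the definition of regular variation to `RegVarTail`. -/

section RegularVariation

variable {Ω : Type*} [MeasurableSpace Ω] {P : Measure Ω} [IsProbabilityMeasure P]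

/-- The quotient by x^(-α) L(x) tends to 1, so the tail is nonzero at arbitrarily large arguments,
hence everywhere by monotonicity. The ratio limit is the quotient of this asymptotics at tx and at
x, combined with slow variation of L. -/
theorem RegularlyVarying.regVarTail {X : Ω → ℝ} {α : ℝ} (h : RegularlyVarying P X α) :
    RegVarTail (tail P X) α := by
  obtain ⟨-, L, hL, hslow, hlim⟩ := h
  have hlim : Tendsto (fun x => tail P X x / (x ^ (-α) * L x)) atTop (𝓝 1) := hlim
  have hpos : ∀ x, 0 < tail P X x := by
    intro x
    obtain ⟨y, hy, hxy⟩ := ((hlim.eventually_const_lt zero_lt_one).and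
      (eventually_ge_atTop x)).exists
    have hne : tail P X y ≠ 0 := fun h0 => by simp [h0] at hy
    exact ((tail_nonneg X y).lt_of_ne' hne).trans_le (tail_antitone X hxy)
  refine ⟨hpos, tail_le_one X, tail_antitone X, fun t ht => ?_⟩
  have h1 : Tendsto (fun x : ℝ => t * x) atTop atTop := tendsto_id.const_mul_atTop ht
  have h2 := (((hlim.comp h1).div hlim one_ne_zero).mul (hslow t ht)).mul_const (t ^ (-α))
  rw [div_one, mul_one, one_mul] at h2
  refine h2.congr' ?_
  filter_upwards [eventually_gt_atTop 0] with x hx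
  have hx1 : (0 : ℝ) < x ^ (-α) := Real.rpow_pos_of_pos hx _
  have ht1 : (0 : ℝ) < t ^ (-α) := Real.rpow_pos_of_pos ht _
  have := hL x hx
  have := hL (t * x) (mul_pos ht hx)
  have := hpos x
  simp only [Function.comp, Pi.div_apply]
  rw [Real.mul_rpow ht.le hx.le]
  field_simp

/-- Markov's inequality on the event itself: x P(X > x) ≤ E(X; X > x), which vanishes by dominated
convergence. -/
theorem tendsto_mul_tail {X : Ω → ℝ} (hX : Measurable X) (hint : Integrable X P) :
    Tendsto (fun x => x * tail P X x) atTop (𝓝 0) := by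
  have hms (x : ℝ) : MeasurableSet {ω | x < X ω} := measurableSet_lt measurable_const hX
  have h := tendsto_integral_filter_of_dominated_convergence (μ := P) (l := atTop)
    (F := fun (x : ℝ) ω => Set.indicator {ω | x < X ω} X ω) (f := fun _ => (0 : ℝ))
    (fun ω => |X ω|)
    (Eventually.of_forall fun x => (hX.indicator (hms x)).aestronglyMeasurable)
    (Eventually.of_forall fun x => ae_of_all _ fun ω => by
      rw [Real.norm_eq_abs]
      by_cases hω : x < X ω <;> simp [Set.indicator, hω])
    hint.abs
    (ae_of_all _ fun ω => tendsto_const_nhds.congr' (by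
      filter_upwards [eventually_ge_atTop (X ω)] with x hx
      simp [Set.indicator, not_lt.2 hx]))
  rw [integral_zero] at h
  refine tendsto_of_tendsto_of_tendsto_of_le_of_le' tendsto_const_nhds h ?_ ?_
  · filter_upwards [eventually_ge_atTop 0] with x hx
    exact mul_nonneg hx (tail_nonneg _ _)
  · refine Eventually.of_forall fun x => ?_
    have h1 : x * tail P X x = ∫ ω, Set.indicator {ω | x < X ω} (fun _ => x) ω ∂P := by
      rw [integral_indicator_const _ (hms x), smul_eq_mul, mul_comm]
      rfl
    rw [h1]
    refine integral_mono ((integrable_const x).indicator (hms x)) (hint.indicator (hms x))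
      fun ω => ?_
    by_cases hω : x < X ω
    · simpa [Set.indicator, hω] using hω.le
    · simp [Set.indicator, hω]

end RegularVariation

end PageRank

/-! ### The main theorem: laws of N and D, and induction on the constants. -/

theorem mainTheorem1 {Ω : Type*} [MeasurableSpace Ω] (P : Measure Ω) [IsProbabilityMeasure P]
    (c α d b : ℝ) (hc0 : 0 < c) (hc1 : c < 1)
    -- the out-degree distribution `p`, with mean `d`
    (p : ℕ → ℝ) (hp : ∀ j, 0 ≤ p j) (hp_sum : HasSum p 1)
    (hp_mean : HasSum (fun j : ℕ => (j : ℝ) * p j) d)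
    -- the in-degree `N`, regularly varying with index `α` and with finite mean `d`
    (N : Ω → ℕ) (hN : Measurable N)
    (hN_int : Integrable (fun ω => (N ω : ℝ)) P) (hN_mean : ∫ ω, (N ω : ℝ) ∂P = d)
    (hN_rv : PageRank.RegularlyVarying P (fun ω => (N ω : ℝ)) α)
    -- the effective out-degree `D`
    (D : Ω → ℕ) (hD : Measurable D)
    (hD_law : ∀ j : ℕ, 1 ≤ j → P.real {ω | D ω = j} = (j : ℝ) * p j / d)
    -- the initial distribution
    (R₀ : Ω → ℝ) (hR₀ : Measurable R₀) (hR₀_int : Integrable R₀ P)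
    (hR₀_mean : ∫ ω, R₀ ω ∂P = 1)
    (hR₀_tail : PageRank.tail P R₀ =o[atTop] PageRank.tail P (fun ω => (N ω : ℝ)))
    (hb : b = d * ∫ ω, 1 / (D ω : ℝ) ^ α ∂P) :
    Integrable (fun ω => 1 / (D ω : ℝ) ^ α) P ∧
    HasSum (fun j : ℕ => p (j + 1) / ((j + 1 : ℕ) : ℝ) ^ (α - 1)) b ∧
    ∀ k : ℕ, 1 ≤ k →
      PageRank.AsympEquiv
        (fun x => (PageRank.iterLaw c (p 0) (PageRank.law P N hN) (PageRank.law P D hD)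
          (PageRank.law P R₀ hR₀) k : Measure ℝ).real (Set.Ioi x))
        (fun x => ((c * (1 - p 0) / d) ^ α *
            ∑ j ∈ Finset.range k, c ^ ((j : ℝ) * α) * b ^ j) *
          PageRank.tail P (fun ω => (N ω : ℝ)) x) := by
  open PageRank in
  set G : ℝ → ℝ := tail P fun ω => (N ω : ℝ) with hGdef
  have hNm : Measurable fun ω => (N ω : ℝ) :=
    (measurable_from_nat (f := fun m : ℕ => (m : ℝ))).comp hN
  have hG : RegVarTail G α := hN_rv.regVarTail
  have hG1 : Tendsto (fun x => x * G x) atTop (𝓝 0) := tendsto_mul_tail hNm hN_int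
  have hα0 : 0 ≤ α := hG.index_nonneg
  -- the mean of `N` is positive and `p 0 < 1`
  have hd : 0 < d := by
    have h0 : 0 < ∫ ω, (N ω : ℝ) ∂P := by
      rw [integral_pos_iff_support_of_nonneg (fun ω => Nat.cast_nonneg _) hN_int]
      have h1 : P {ω | (0 : ℝ) < N ω} ≠ 0 := fun h => by
        have := hG.pos 0
        rw [hGdef, tail, measureReal_def, h] at this
        simp at this
      exact (pos_iff_ne_zero.2 h1).trans_le (measure_mono fun ω hω => ne_of_gt hω)
    rwa [hN_mean] at h0
  have hp0 : p 0 < 1 := by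
    by_contra! h
    have h1 : ∀ j, 1 ≤ j → p j = 0 := fun j hj => by
      have h2 := sum_le_hasSum {0, j} (fun i _ => hp i) hp_sum
      rw [Finset.sum_pair (by omega)] at h2
      have := hp j
      linarith
    have h3 : HasSum (fun j : ℕ => (j : ℝ) * p j) 0 := by
      convert hasSum_zero (α := ℝ) (β := ℕ) with j
      rcases Nat.eq_zero_or_pos j with rfl | hj
      · simp
      · rw [h1 j hj, mul_zero]
    exact hd.ne' (hp_mean.unique h3)
  -- the law of `D`
  set lawD := law P D hD with hlawD
  have hlawDm : (lawD : Measure ℕ) = P.map D := rfl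
  have hDj (j : ℕ) (hj : 1 ≤ j) : (lawD : Measure ℕ).real {j} = j * p j / d := by
    rw [hlawDm, map_measureReal_apply hD (MeasurableSet.singleton j), ← hD_law j hj]
    rfl
  -- The prescribed masses j p_j / d over j ≥ 1 already add up to 1.
  have hD0 : (lawD : Measure ℕ).real {0} = 0 := by
    have h1 : HasSum (fun j : ℕ => (lawD : Measure ℕ).real {j}) 1 := by
      simpa using hasSum_integral_nat (μ := (lawD : Measure ℕ)) (integrable_const (1 : ℝ))
    have h2 : HasSum (fun j : ℕ => (lawD : Measure ℕ).real {j + 1}) 1 := by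
      have h3 := (hasSum_nat_add_iff' 1).2 (hp_mean.div_const d)
      simp only [Finset.sum_range_one, Nat.cast_zero, zero_mul, zero_div, sub_zero,
        div_self hd.ne'] at h3
      exact h3.congr_fun fun j => hDj (j + 1) (by omega)
    have h4 := ((hasSum_nat_add_iff' 1).2 h1).unique h2
    simp only [Finset.sum_range_one] at h4
    linarith
  have hint (f : ℕ → ℝ) (hf : ∀ j, |f j| ≤ 1) : Integrable f (lawD : Measure ℕ) :=
    Integrable.of_bound (C := 1) (measurable_of_countable _).aestronglyMeasurable
      (ae_of_all _ hf)
  have hshift (f : ℕ → ℝ) (hf : ∀ j, |f j| ≤ 1) :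
      HasSum (fun j : ℕ => ((j + 1 : ℕ) : ℝ) * p (j + 1) / d * f (j + 1))
        (∫ j, f j ∂(lawD : Measure ℕ)) := by
    have h1 := (hasSum_nat_add_iff' 1).2 (hasSum_integral_nat (hint f hf))
    simp only [Finset.sum_range_one, hD0, zero_mul, sub_zero] at h1
    exact h1.congr_fun fun j => by rw [hDj (j + 1) (by omega)]
  have hαb (j : ℕ) : |1 / (j : ℝ) ^ α| ≤ 1 := by
    have h0 : (0 : ℝ) ≤ (j : ℝ) ^ α := by positivity
    rw [abs_of_nonneg (by positivity)]
    -- At j = 0 the conventions 0^0 = 1 and 1/0 = 0 give the value 1 if α = 0 and 0 otherwise.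
    rcases Nat.eq_zero_or_pos j with rfl | hj
    · rcases hα0.eq_or_lt with h | h
      · simp [← h]
      · simp [Real.zero_rpow h.ne']
    · have hj : (1 : ℝ) ≤ j := by exact_mod_cast hj
      exact div_le_one_of_le₀ (Real.one_le_rpow hj hα0) h0
  have h1b (j : ℕ) : |1 / (j : ℝ)| ≤ 1 := by
    rw [abs_of_nonneg (by positivity)]
    rcases Nat.eq_zero_or_pos j with rfl | hj
    · simp
    · have hj : (1 : ℝ) ≤ j := by exact_mod_cast hj
      exact div_le_one_of_le₀ hj (by linarith)
  have hDα := hint _ hαb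
  have hDαP : ∫ ω, 1 / (D ω : ℝ) ^ α ∂P = ∫ j : ℕ, 1 / (j : ℝ) ^ α ∂(lawD : Measure ℕ) := by
    rw [hlawDm, integral_map hD.aemeasurable (measurable_of_countable _).aestronglyMeasurable]
  have hDmean : ∫ j : ℕ, 1 / (j : ℝ) ∂(lawD : Measure ℕ) = (1 - p 0) / d := by
    refine (hshift _ h1b).unique ?_
    have h3 := ((hasSum_nat_add_iff' 1).2 hp_sum).div_const d
    simp only [Finset.sum_range_one] at h3
    refine h3.congr_fun fun j => ?_
    have : ((j + 1 : ℕ) : ℝ) ≠ 0 := by positivity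
    field_simp
  have hb0 : 0 ≤ b := by
    rw [hb]
    exact mul_nonneg hd.le (integral_nonneg fun ω => by positivity)
  refine ⟨?_, ?_, ?_⟩
  · rw [hlawDm] at hDα
    exact hDα.comp_measurable hD
  · rw [hb, hDαP]
    refine ((hshift _ hαb).mul_left d).congr_fun fun j => ?_
    have h0 : (0 : ℝ) < ((j + 1 : ℕ) : ℝ) := by positivity
    have h1 : (0 : ℝ) < ((j + 1 : ℕ) : ℝ) ^ α := Real.rpow_pos_of_pos h0 _
    rw [Real.rpow_sub_one h0.ne']
    field_simp
  -- the recursion for the tail constants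
  set lawN := law P N hN with hlawN
  have hlawNm : (lawN : Measure ℕ) = P.map N := rfl
  have hGN (x : ℝ) : G x = (lawN : Measure ℕ).real {n : ℕ | x < n} := by
    rw [hlawNm, map_measureReal_apply hN MeasurableSet.of_discrete]
    rfl
  have hNi : Integrable (fun n : ℕ => (n : ℝ)) (lawN : Measure ℕ) := by
    rw [hlawNm, integrable_map_measure (measurable_of_countable _).aestronglyMeasurable
      hN.aemeasurable]
    exact hN_int
  have hNd : ∫ n : ℕ, (n : ℝ) ∂(lawN : Measure ℕ) = d := by
    rw [hlawNm, integral_map hN.aemeasurable (measurable_of_countable _).aestronglyMeasurable,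
      hN_mean]
  set C : ℕ → ℝ := fun k =>
    (c * (1 - p 0) / d) ^ α * ∑ j ∈ Finset.range k, c ^ ((j : ℝ) * α) * b ^ j with hC
  -- The affine map of `iterStep_spec` sends C k to C (k + 1): the sum shifts by one index and the
  -- new term j = 0 comes from the law of large numbers contribution.
  have hCsucc (k : ℕ) : (((1 - p 0) / d) ^ α +
      d * (C k * ∫ j : ℕ, 1 / (j : ℝ) ^ α ∂(lawD : Measure ℕ))) * c ^ α = C (k + 1) := by
    have hq : 0 ≤ (1 - p 0) / d := div_nonneg (by linarith) hd.le
    have h1 : (c * (1 - p 0) / d) ^ α = c ^ α * ((1 - p 0) / d) ^ α := by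
      rw [mul_div_assoc, Real.mul_rpow hc0.le hq]
    have h2 (j : ℕ) : c ^ (((j + 1 : ℕ) : ℝ) * α) = c ^ α * c ^ ((j : ℝ) * α) := by
      rw [← Real.rpow_add hc0]; push_cast; congr 1; ring
    have h3 : ∑ j ∈ Finset.range (k + 1), c ^ ((j : ℝ) * α) * b ^ j =
        c ^ α * b * (∑ j ∈ Finset.range k, c ^ ((j : ℝ) * α) * b ^ j) + 1 := by
      rw [Finset.sum_range_succ', Finset.mul_sum]
      simp only [h2, Nat.cast_zero, zero_mul, Real.rpow_zero, pow_zero, mul_one]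
      congr 1
      exact Finset.sum_congr rfl fun j _ => by ring
    have h4 : d * (C k * ∫ j : ℕ, 1 / (j : ℝ) ^ α ∂(lawD : Measure ℕ)) = b * C k := by
      rw [hb, hDαP]; ring
    rw [h4]
    simp only [hC]
    rw [h3, h1]
    ring
  have key : ∀ k, Integrable (fun r : ℝ => r)
        (iterLaw c (p 0) lawN lawD (law P R₀ hR₀) k : Measure ℝ) ∧
      ∫ r, r ∂(iterLaw c (p 0) lawN lawD (law P R₀ hR₀) k : Measure ℝ) = 1 ∧
      Tendsto (fun x => (iterLaw c (p 0) lawN lawD (law P R₀ hR₀) k : Measure ℝ).real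
        (Set.Ioi x) / G x) atTop (𝓝 (C k)) := by
    intro k
    induction k with
    | zero =>
      have hl : (iterLaw c (p 0) lawN lawD (law P R₀ hR₀) 0 : Measure ℝ) = P.map R₀ := rfl
      rw [hl]
      refine ⟨?_, ?_, ?_⟩
      · rw [integrable_map_measure measurable_id'.aestronglyMeasurable hR₀.aemeasurable]
        exact hR₀_int
      · rw [integral_map hR₀.aemeasurable measurable_id'.aestronglyMeasurable]
        exact hR₀_mean
      · have h0 : C 0 = 0 := by simp [hC]
        rw [h0]
        refine hR₀_tail.tendsto_div_nhds_zero.congr fun x => ?_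
        rw [map_measureReal_apply hR₀ measurableSet_Ioi]
        rfl
    | succ k ih =>
      obtain ⟨ih1, ih2, ih3⟩ := ih
      rw [← hCsucc k]
      exact iterStep_spec hG hG1 hc0 hd hp0 hGN hNi hNd hD0 (hint _ h1b) hDmean hDα ih1 ih2 ih3
  intro k hk
  -- Needed to pass from a limit of ratios to equivalence; for k ≥ 1 the summand j = 0 equals 1.
  have hCpos : 0 < C k := by
    have h1 : 0 < (c * (1 - p 0) / d) ^ α :=
      Real.rpow_pos_of_pos (div_pos (mul_pos hc0 (by linarith)) hd) _
    refine mul_pos h1 (Finset.sum_pos' (fun j _ => ?_) ⟨0, Finset.mem_range.2 hk, by simp⟩)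
    exact mul_nonneg (Real.rpow_nonneg hc0.le _) (pow_nonneg hb0 _)
  have h := (key k).2.2.div_const (C k)
  rw [div_self hCpos.ne'] at h
  refine h.congr fun x => ?_
  rw [div_div, mul_comm (G x)]
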